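/- Let $V=\mathbb C^5$ be the fundamental representation of $\mathfrak{sl}(5;\mathbb C)$ and identify $\mathbb C^{10}=V\oplus V^*$ with the quadratic form given by the evaluation pairing, so that $\mathfrak{sl}(5;\mathbb C)\subset\mathfrak{so}(10;\mathbb C)$. Let $S_+=\wedge^{\mathrm{even}}V$ be the positive spin representation of $\mathfrak{so}(10;\mathbb C)$, let $\Gamma^+:\mathrm{Sym}^2S_+\to\mathbb C^{10}$ be the equivariant projection (unique up to a nonzero scalar, which is fixed by the formula $\langle\Gamma^+(s,t),v\rangle=\int s^{t}\wedge (v\cdot t)$, where $s^t$ is the reversal of $s$, $v\cdot t$ is Clifford multiplication and $\int$ is the coefficient of the top form), and let $e_1,e_2$ be the standard basis of $\mathbb C^2$, orthonormal for the standard bilinear inner product. The 10-dimensional $\mathcal N=(2,0)$ supersymmetry algebra is the Lie superalgebra $$\mathfrak{siso}_{\mathrm{IIB}}=\mathfrak{so}(10;\mathbb C)\ltimes\bigl(\mathbb C^{10}\oplus\Pi(S_+\otimes\mathbb C^2)\bigr),\qquad [\psi_1\otimes\alpha,\psi_2\otimes\beta]=\Gamma^+(\psi_1,\psi_2)\langle\alpha,\beta\rangle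 .$$ Lemma. Let $0\neq\psi\in S_+$ be $\mathfrak{sl}(5;\mathbb C)$-invariant and $Q=\psi\otimes e_1$. Then $[Q,Q]=0$, and the cohomology $H^\bullet(\mathfrak{siso}_{\mathrm{IIB}};Q)$ of the differential $[Q,-]$, with its induced bracket, is a Lie superalgebra with underlying $\mathbb Z/2\mathbb Z$-graded vector space $$\mathfrak{sl}(5;\mathbb C)\oplus\wedge^3V\oplus V\oplus\Pi(\mathbb C\oplus\wedge^2V\oplus V^*),$$ where $\mathfrak{sl}(5;\mathbb C)\oplus\wedge^3V$ consists of the classes of the elements of the stabilizer of $\psi$ in $\mathfrak{so}(10;\mathbb C)$ (with $\mathfrak{sl}(5;\mathbb C)$ embedded in the standard way), $V$ consists of the classes of the translations in $V\subset\mathbb C^{10}$, and $\mathbb C\oplus\wedge^2V\oplus V^*\cong S_+$ consists of the classes of the elements of $S_+\otimes e_2$. The subalgebra $\mathfrak{sl}(5;\mathbb C)$ acts on every summand in the natural way, $\wedge^3V$ is an abelian ideal of $\mathfrak{sl}(5;\mathbb C)\oplus\wedge^3V$ and commutes with $V$, and $V$ is abelian. The Lie superalgebra $H^\bullet(\mathfrak{siso}_{\mathrm{IIB}};Q)$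 is the semidirect product of the subalgebra $\mathfrak{sl}(5;\mathbb C)\oplus\wedge^3V\subset\mathfrak{so}(10;\mathbb C)$ with the ideal $V\oplus\Pi(\mathbb C\oplus\wedge^2V\oplus V^*)$. -/

import Mathlib

open scoped TensorProduct Matrix

attribute [local instance] LieRing.ofAssociativeRing

/-- A complex Lie superalgebra with even part `L₀` and odd part `L₁`. The super bracket is given by
its components `b00 = [even, even]`, `b01 = [even, odd]`, `b11 = [odd, odd]`; the component
`[odd, even]` is `-b01` with the arguments exchanged. The fields are super skew-symmetry and the
super Jacobi identity in each parity. -/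
structure LieSuperalgebra (L₀ L₁ : Type*) [AddCommGroup L₀] [Module ℂ L₀]
    [AddCommGroup L₁] [Module ℂ L₁] where
  b00 : L₀ →ₗ[ℂ] L₀ →ₗ[ℂ] L₀
  b01 : L₀ →ₗ[ℂ] L₁ →ₗ[ℂ] L₁
  b11 : L₁ →ₗ[ℂ] L₁ →ₗ[ℂ] L₀
  b00_self : ∀ x, b00 x x = 0
  b11_comm : ∀ a b, b11 a b = b11 b a
  jacobi000 : ∀ x y z, b00 x (b00 y z) = b00 (b00 x y) z + b00 y (b00 x z)
  jacobi001 : ∀ x y a, b01 x (b01 y a) = b01 (b00 x y) a + b01 y (b01 x a)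
  jacobi011 : ∀ x a b, b00 x (b11 a b) = b11 (b01 x a) b + b11 a (b01 x b)
  jacobi111 : ∀ a b c, b01 (b11 a b) c + b01 (b11 b c) a + b01 (b11 c a) b = 0

namespace LieSuperalgebra

/-- The bilinear map induced on quotients by a bilinear map that vanishes on the submodules. -/
def quotBil {M N P : Type*} [AddCommGroup M] [Module ℂ M] [AddCommGroup N] [Module ℂ N]
    [AddCommGroup P] [Module ℂ P] (p : Submodule ℂ M) (q : Submodule ℂ N)
    (f : M →ₗ[ℂ] N →ₗ[ℂ] P) (hp : ∀ x ∈ p, ∀ y, f x y = 0) (hq : ∀ x, ∀ y ∈ q, f x y = 0) :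
    (M ⧸ p) →ₗ[ℂ] (N ⧸ q) →ₗ[ℂ] P :=
  f.liftQ₂ p q (fun x hx => LinearMap.ext fun y => hp x hx y)
    (fun y hy => LinearMap.ext fun x => hq x y hy)

variable {L₀ L₁ : Type*} [AddCommGroup L₀] [Module ℂ L₀] [AddCommGroup L₁] [Module ℂ L₁]
variable (g : LieSuperalgebra L₀ L₁) (Q : L₁)

theorem b00_comm (x y : L₀) : g.b00 x y = -g.b00 y x := by
  have h := g.b00_self (x + y)
  simp only [map_add, LinearMap.add_apply, g.b00_self, zero_add, add_zero] at h
  exact eq_neg_of_add_eq_zero_left ((add_comm _ _).trans h)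

/-- The differential `x ↦ [Q, x] = -[x, Q]` on the even part. -/
def d₀ : L₀ →ₗ[ℂ] L₁ := -g.b01.flip Q

/-- The differential `a ↦ [Q, a]` on the odd part. -/
def d₁ : L₁ →ₗ[ℂ] L₀ := g.b11 Q

theorem d₁_d₀ (hQ : g.b11 Q Q = 0) (x : L₀) : g.d₁ Q (g.d₀ Q x) = 0 := by
  have h := g.jacobi011 x Q Q
  rw [hQ, map_zero, g.b11_comm (g.b01 x Q) Q, ← two_smul ℂ] at h
  have h2 : g.b11 Q (g.b01 x Q) = 0 := by
    rcases smul_eq_zero.1 h.symm with h | h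
    · norm_num at h
    · exact h
  simp [d₁, d₀, h2]

theorem d₀_d₁ (hQ : g.b11 Q Q = 0) (a : L₁) : g.d₀ Q (g.d₁ Q a) = 0 := by
  have h := g.jacobi111 Q Q a
  rw [hQ, map_zero, LinearMap.zero_apply, zero_add, g.b11_comm a Q, ← two_smul ℂ] at h
  rcases smul_eq_zero.1 h with h | h
  · norm_num at h
  · simp [d₁, d₀, h]

/-- Even cocycles `{x | [Q, x] = 0}`. -/
abbrev Z₀ : Submodule ℂ L₀ := LinearMap.ker (g.d₀ Q)

/-- Odd cocycles `{a | [Q, a] = 0}`. -/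
abbrev Z₁ : Submodule ℂ L₁ := LinearMap.ker (g.d₁ Q)

/-- Even coboundaries `[Q, L₁]`, as a subspace of the even cocycles (when `[Q, Q] = 0`, every
`[Q, a]` is a cocycle). -/
abbrev B₀ : Submodule ℂ (g.Z₀ Q) := (LinearMap.range (g.d₁ Q)).comap (g.Z₀ Q).subtype

/-- Odd coboundaries `[Q, L₀]`, as a subspace of the odd cocycles. -/
abbrev B₁ : Submodule ℂ (g.Z₁ Q) := (LinearMap.range (g.d₀ Q)).comap (g.Z₁ Q).subtype

/-- The even part of the cohomology of `[Q, -]`. -/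
abbrev H₀ : Type _ := g.Z₀ Q ⧸ g.B₀ Q

/-- The odd part of the cohomology of `[Q, -]`. -/
abbrev H₁ : Type _ := g.Z₁ Q ⧸ g.B₁ Q

variable {Q}

theorem mem_Z₀ {x : L₀} : x ∈ g.Z₀ Q ↔ g.b01 x Q = 0 := by
  simp [d₀]

theorem mem_Z₁ {a : L₁} : a ∈ g.Z₁ Q ↔ g.b11 Q a = 0 := by
  simp [d₁]

variable (Q)

/-- The class of an even cocycle. -/
abbrev mk₀ (x : L₀) (hx : x ∈ g.Z₀ Q) : g.H₀ Q := (g.B₀ Q).mkQ ⟨x, hx⟩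

/-- The class of an odd cocycle. -/
abbrev mk₁ (a : L₁) (ha : a ∈ g.Z₁ Q) : g.H₁ Q := (g.B₁ Q).mkQ ⟨a, ha⟩

theorem mk₀_eq_zero {x : L₀} (hx : x ∈ g.Z₀ Q) (a : L₁) (h : g.b11 Q a = x) :
    g.mk₀ Q x hx = 0 := by
  rw [mk₀, Submodule.mkQ_apply, Submodule.Quotient.mk_eq_zero]
  exact ⟨a, h⟩

theorem mk₁_eq_zero {a : L₁} (ha : a ∈ g.Z₁ Q) (x : L₀) (h : -g.b01 x Q = a) :
    g.mk₁ Q a ha = 0 := by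
  rw [mk₁, Submodule.mkQ_apply, Submodule.Quotient.mk_eq_zero]
  exact ⟨x, h⟩

theorem b00_mem {x y : L₀} (hx : x ∈ g.Z₀ Q) (hy : y ∈ g.Z₀ Q) : g.b00 x y ∈ g.Z₀ Q := by
  rw [mem_Z₀] at *
  have h := g.jacobi001 x y Q
  rw [hx, hy, map_zero, map_zero, add_zero] at h
  exact h.symm

theorem b01_mem {x : L₀} {a : L₁} (hx : x ∈ g.Z₀ Q) (ha : a ∈ g.Z₁ Q) : g.b01 x a ∈ g.Z₁ Q := by
  rw [mem_Z₀] at hx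
  rw [mem_Z₁] at *
  have h := g.jacobi011 x Q a
  rw [hx, ha, map_zero, map_zero, LinearMap.zero_apply, zero_add] at h
  exact h.symm

theorem b11_mem {a b : L₁} (ha : a ∈ g.Z₁ Q) (hb : b ∈ g.Z₁ Q) : g.b11 a b ∈ g.Z₀ Q := by
  rw [mem_Z₀]
  rw [mem_Z₁] at *
  have h := g.jacobi111 a b Q
  rw [g.b11_comm b Q, ha, hb] at h
  simpa using h

/-- The bracket of even classes, `[[x], [y]] = [[x, y]]`. -/
def coh00 : g.H₀ Q →ₗ[ℂ] g.H₀ Q →ₗ[ℂ] g.H₀ Q :=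
  have key : ∀ (x : L₀) (hx : x ∈ g.Z₀ Q) (a : L₁) (h : g.b00 x (g.b11 Q a) ∈ g.Z₀ Q),
      g.mk₀ Q _ h = 0 := fun x hx a h => by
    refine g.mk₀_eq_zero Q h (g.b01 x a) ?_
    rw [g.jacobi011, (g.mem_Z₀).1 hx, map_zero, LinearMap.zero_apply, zero_add]
  quotBil _ _
    (LinearMap.mk₂ ℂ (fun x y : g.Z₀ Q => g.mk₀ Q (g.b00 x y) (g.b00_mem Q x.2 y.2))
      (fun x y z => by rw [← map_add]; exact congrArg _ (Subtype.ext (by simp)))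
      (fun c x y => by rw [← map_smul]; exact congrArg _ (Subtype.ext (by simp)))
      (fun x y z => by rw [← map_add]; exact congrArg _ (Subtype.ext (by simp)))
      (fun c x y => by rw [← map_smul]; exact congrArg _ (Subtype.ext (by simp))))
    (by
      rintro ⟨x, hx⟩ ⟨a, rfl⟩ ⟨y, hy⟩
      have h := key y hy a (g.b00_mem Q hy hx)
      rw [← neg_eq_zero, ← map_neg] at h
      rw [← h, LinearMap.mk₂_apply]
      exact congrArg _ (Subtype.ext (g.b00_comm _ _)))
    (by
      rintro ⟨x, hx⟩ ⟨y, hy⟩ ⟨a, rfl⟩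
      exact key x hx a _)

/-- The bracket of an even and an odd class. -/
def coh01 : g.H₀ Q →ₗ[ℂ] g.H₁ Q →ₗ[ℂ] g.H₁ Q :=
  quotBil _ _
    (LinearMap.mk₂ ℂ (fun (x : g.Z₀ Q) (a : g.Z₁ Q) =>
        g.mk₁ Q (g.b01 x a) (g.b01_mem Q x.2 a.2))
      (fun x y z => by rw [← map_add]; exact congrArg _ (Subtype.ext (by simp)))
      (fun c x y => by rw [← map_smul]; exact congrArg _ (Subtype.ext (by simp)))
      (fun x y z => by rw [← map_add]; exact congrArg _ (Subtype.ext (by simp)))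
      (fun c x y => by rw [← map_smul]; exact congrArg _ (Subtype.ext (by simp))))
    (by
      rintro ⟨x, hx⟩ ⟨a, rfl⟩ ⟨b, hb⟩
      refine g.mk₁_eq_zero Q _ (g.b11 a b) ?_
      have h := g.jacobi111 Q a b
      rw [g.b11_comm b Q, (g.mem_Z₁).1 hb, map_zero, LinearMap.zero_apply, add_zero] at h
      exact (eq_neg_of_add_eq_zero_left h).symm)
    (by
      rintro ⟨x, hx⟩ ⟨b, hb⟩ ⟨y, rfl⟩
      refine g.mk₁_eq_zero Q _ (g.b00 x y) ?_
      have h := g.jacobi001 x y Q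
      rw [(g.mem_Z₀).1 hx, map_zero, add_zero] at h
      simp [d₀, h])

/-- The bracket of odd classes. -/
def coh11 : g.H₁ Q →ₗ[ℂ] g.H₁ Q →ₗ[ℂ] g.H₀ Q :=
  have key : ∀ (x : L₀) (b : L₁) (hb : b ∈ g.Z₁ Q) (h : g.b11 (g.d₀ Q x) b ∈ g.Z₀ Q),
      g.mk₀ Q _ h = 0 := fun x b hb h => by
    refine g.mk₀_eq_zero Q h (g.b01 x b) ?_
    have h := g.jacobi011 x Q b
    rw [(g.mem_Z₁).1 hb, map_zero] at h
    simp [d₀, eq_neg_of_add_eq_zero_right h.symm]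
  quotBil _ _
    (LinearMap.mk₂ ℂ (fun (a b : g.Z₁ Q) => g.mk₀ Q (g.b11 a b) (g.b11_mem Q a.2 b.2))
      (fun x y z => by rw [← map_add]; exact congrArg _ (Subtype.ext (by simp)))
      (fun c x y => by rw [← map_smul]; exact congrArg _ (Subtype.ext (by simp)))
      (fun x y z => by rw [← map_add]; exact congrArg _ (Subtype.ext (by simp)))
      (fun c x y => by rw [← map_smul]; exact congrArg _ (Subtype.ext (by simp))))
    (by
      rintro ⟨a, ha⟩ ⟨x, rfl⟩ ⟨b, hb⟩
      exact key x b hb _)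
    (by
      rintro ⟨b, hb⟩ ⟨a, ha⟩ ⟨x, rfl⟩
      rw [← key x b hb (g.b11_mem Q ha hb), LinearMap.mk₂_apply]
      exact congrArg _ (Subtype.ext (g.b11_comm _ _)))

/-- The cohomology of `[Q, -]` with the induced Lie superalgebra structure. -/
def cohomology : LieSuperalgebra (g.H₀ Q) (g.H₁ Q) where
  b00 := g.coh00 Q
  b01 := g.coh01 Q
  b11 := g.coh11 Q
  b00_self := by
    rintro ⟨x⟩
    exact g.mk₀_eq_zero Q (g.b00_mem Q x.2 x.2) 0 (by simp [g.b00_self])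
  b11_comm := by
    rintro ⟨a⟩ ⟨b⟩
    exact congrArg (g.B₀ Q).mkQ (Subtype.ext (g.b11_comm a.1 b.1))
  jacobi000 := by
    rintro ⟨x⟩ ⟨y⟩ ⟨z⟩
    refine Eq.trans (congrArg (g.B₀ Q).mkQ (Subtype.ext ?_)) (map_add (g.B₀ Q).mkQ _ _)
    exact g.jacobi000 x.1 y.1 z.1
  jacobi001 := by
    rintro ⟨x⟩ ⟨y⟩ ⟨a⟩
    refine Eq.trans (congrArg (g.B₁ Q).mkQ (Subtype.ext ?_)) (map_add (g.B₁ Q).mkQ _ _)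
    exact g.jacobi001 x.1 y.1 a.1
  jacobi011 := by
    rintro ⟨x⟩ ⟨a⟩ ⟨b⟩
    refine Eq.trans (congrArg (g.B₀ Q).mkQ (Subtype.ext ?_)) (map_add (g.B₀ Q).mkQ _ _)
    exact g.jacobi011 x.1 a.1 b.1
  jacobi111 := by
    rintro ⟨a⟩ ⟨b⟩ ⟨c⟩
    refine g.mk₁_eq_zero Q (add_mem (add_mem (g.b01_mem Q (g.b11_mem Q a.2 b.2) c.2)
      (g.b01_mem Q (g.b11_mem Q b.2 c.2) a.2)) (g.b01_mem Q (g.b11_mem Q c.2 a.2) b.2)) 0 ?_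
    simp [g.jacobi111]

/-- The graded subspace `p₀ ⊕ p₁` is a Lie sub-superalgebra. -/
structure IsSubalgebra (p₀ : Submodule ℂ L₀) (p₁ : Submodule ℂ L₁) : Prop where
  b00_mem : ∀ x ∈ p₀, ∀ y ∈ p₀, g.b00 x y ∈ p₀
  b01_mem : ∀ x ∈ p₀, ∀ a ∈ p₁, g.b01 x a ∈ p₁
  b11_mem : ∀ a ∈ p₁, ∀ b ∈ p₁, g.b11 a b ∈ p₀

/-- The graded subspace `n₀ ⊕ n₁` is an ideal. -/
structure IsIdeal (n₀ : Submodule ℂ L₀) (n₁ : Submodule ℂ L₁) : Prop where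
  b00_mem : ∀ x, ∀ y ∈ n₀, g.b00 x y ∈ n₀
  b01_mem : ∀ x, ∀ a ∈ n₁, g.b01 x a ∈ n₁
  b01_mem' : ∀ x ∈ n₀, ∀ a, g.b01 x a ∈ n₁
  b11_mem : ∀ a, ∀ b ∈ n₁, g.b11 a b ∈ n₀

/-- The Lie superalgebra is the semidirect product of the sub-superalgebra `p₀ ⊕ p₁` with the ideal
`n₀ ⊕ n₁`. -/
structure IsSemidirectProduct (p₀ : Submodule ℂ L₀) (p₁ : Submodule ℂ L₁)
    (n₀ : Submodule ℂ L₀) (n₁ : Submodule ℂ L₁) : Prop where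
  isSubalgebra : g.IsSubalgebra p₀ p₁
  isIdeal : g.IsIdeal n₀ n₁
  isCompl₀ : IsCompl p₀ n₀
  isCompl₁ : IsCompl p₁ n₁

end LieSuperalgebra

namespace IIB

/-- The fundamental representation of `sl(5)`. -/
abbrev V : Type := Fin 5 → ℂ

/-- The vector representation `ℂ¹⁰ = V ⊕ V*`; the second summand is `V*` in dual coordinates. -/
abbrev Vec : Type := Fin 5 ⊕ Fin 5 → ℂ

/-- The action of an endomorphism `f` on `⋀ᵏ V` by derivations:
`v₁ ∧ ⋯ ∧ vₖ ↦ ∑ᵢ v₁ ∧ ⋯ ∧ f vᵢ ∧ ⋯ ∧ vₖ`. -/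
noncomputable def extAct (k : ℕ) (f : V →ₗ[ℂ] V) : ⋀[ℂ]^k V →ₗ[ℂ] ⋀[ℂ]^k V :=
  exteriorPower.alternatingMapLinearEquiv
    { toMultilinearMap := ∑ i : Fin k, (exteriorPower.ιMulti ℂ k (M := V)).toMultilinearMap.compLinearMap
        (Function.update (fun _ => LinearMap.id) i f)
      map_eq_zero_of_eq' := by
        intro v a b hab hne
        have term : ∀ i, (fun j => Function.update (fun _ : Fin k => (LinearMap.id : V →ₗ[ℂ] V)) i f j (v j))
            = Function.update v i (f (v i)) := by
          intro i; ext1 j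
          by_cases h : j = i
          · subst h; simp
          · simp [h]
        simp only [MultilinearMap.toFun_eq_coe, sum_apply,
          MultilinearMap.compLinearMap_apply, term, AlternatingMap.coe_multilinearMap]
        rw [← Finset.add_sum_erase _ _ (Finset.mem_univ a),
          ← Finset.add_sum_erase _ _ (Finset.mem_erase.2 ⟨hne.symm, Finset.mem_univ b⟩),
          Finset.sum_eq_zero, add_zero]
        · have : Function.update v b (f (v b)) = Function.update v a (f (v a)) ∘ Equiv.swap a b := by
            ext1 j
            by_cases hj : j = a
            · subst hj; simp [hne, hne.symm, hab]
            · by_cases hj' : j = b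
              · subst hj'; simp [hab]
              · simp [hj, hj', Equiv.swap_apply_of_ne_of_ne]
          rw [this]
          exact AlternatingMap.map_add_swap _ _ hne
        · intro i hi
          simp only [Finset.mem_erase, Finset.mem_univ, and_true] at hi
          exact AlternatingMap.map_eq_zero_of_eq _ _
            (by simp [Function.update_of_ne hi.1.symm, Function.update_of_ne hi.2.symm, hab]) hne }

theorem extAct_ιMulti (k : ℕ) (f : V →ₗ[ℂ] V) (v : Fin k → V) :
    extAct k f (exteriorPower.ιMulti ℂ k v) =
      ∑ i, exteriorPower.ιMulti ℂ k (Function.update v i (f (v i))) := by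
  rw [extAct, exteriorPower.alternatingMapLinearEquiv_apply_ιMulti]
  change (MultilinearMap.toFun _) v = _
  simp only [MultilinearMap.toFun_eq_coe, sum_apply,
          MultilinearMap.compLinearMap_apply, AlternatingMap.coe_multilinearMap]
  refine Finset.sum_congr rfl fun i _ => congrArg _ ?_
  ext1 j
  by_cases h : j = i
  · subst h; simp
  · simp [h]

/-- Dirac spinors of `ℂ¹⁰ = V ⊕ V*`: the exterior algebra of `V`. -/
abbrev Spinor : Type := ExteriorAlgebra ℂ V

/-- Clifford multiplication on spinors: `V` acts by exterior multiplication, `V*` by contraction. -/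
noncomputable def cliff : Vec →ₗ[ℂ] Module.End ℂ Spinor :=
  LinearMap.mul ℂ Spinor ∘ₗ ExteriorAlgebra.ι ℂ ∘ₗ LinearMap.funLeft ℂ ℂ Sum.inl +
    CliffordAlgebra.contractLeft ∘ₗ dotProductBilin ℂ ℂ ∘ₗ LinearMap.funLeft ℂ ℂ Sum.inr

theorem cliff_apply (v : Vec) (x : Spinor) :
    cliff v x = ExteriorAlgebra.ι ℂ (v ∘ Sum.inl) * x +
      CliffordAlgebra.contractLeft (dotProductBilin ℂ ℂ (v ∘ Sum.inr)) x := rfl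

/-- The symmetric form on `ℂ¹⁰ = V ⊕ V*` given by the evaluation pairing. -/
noncomputable def pair : Vec →ₗ[ℂ] Vec →ₗ[ℂ] ℂ := Matrix.toBilin' (LieAlgebra.Orthogonal.JD (Fin 5) ℂ)

theorem pair_apply (v w : Vec) : pair v w = ∑ a, v a * w a.swap := by
  simp [pair, Matrix.toBilin'_apply', LieAlgebra.Orthogonal.JD, dotProduct, Fintype.sum_sum_type,
    Matrix.fromBlocks_mulVec]

theorem cliff_anticomm (v w : Vec) :
    cliff v * cliff w + cliff w * cliff v = pair v w • 1 := by
  refine LinearMap.ext fun x => ?_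
  have h1 := ExteriorAlgebra.ι_add_mul_swap (R := ℂ) (v ∘ Sum.inl) (w ∘ Sum.inl)
  have h2 : ExteriorAlgebra.ι ℂ (v ∘ Sum.inl) * (ExteriorAlgebra.ι ℂ (w ∘ Sum.inl) * x) =
    - (ExteriorAlgebra.ι ℂ (w ∘ Sum.inl) * (ExteriorAlgebra.ι ℂ (v ∘ Sum.inl) * x)) := by
    rw [← mul_assoc, ← mul_assoc, eq_neg_iff_add_eq_zero, ← add_mul, h1, zero_mul]
  have h3 := CliffordAlgebra.contractLeft_comm (Q := (0 : QuadraticForm ℂ V))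
    (dotProductBilin ℂ ℂ (v ∘ Sum.inr)) (dotProductBilin ℂ ℂ (w ∘ Sum.inr)) x
  simp only [LinearMap.add_apply, Module.End.mul_apply, cliff_apply, map_add, mul_add, h2, h3,
    LinearMap.smul_apply, Module.End.one_apply, pair_apply, Fintype.sum_sum_type, Sum.swap_inl,
    Sum.swap_inr]
  have h4 : ∀ (d : Module.Dual ℂ V) (a : V) (y : Spinor),
      CliffordAlgebra.contractLeft d (ExteriorAlgebra.ι ℂ a * y) =
        d a • y - ExteriorAlgebra.ι ℂ a * CliffordAlgebra.contractLeft d y :=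
    fun d a y => CliffordAlgebra.contractLeft_ι_mul d a y
  rw [h4, h4]
  simp only [dotProductBilin, LinearMap.coe_mk, AddHom.coe_mk, dotProduct, Function.comp_apply, add_smul]
  simp only [mul_comm (w _)]
  abel

/-- `A ↦ ½ ∑ₐ (A wₐ) · wᵃ` for a basis `wₐ` of `ℂ¹⁰` with dual basis `wᵃ`. On `so(10)` this is the spin
representation on Dirac spinors (`spinMat_lie`), characterized by `spinMat_commutator`. -/
noncomputable def spinMat : Matrix (Fin 5 ⊕ Fin 5) (Fin 5 ⊕ Fin 5) ℂ →ₗ[ℂ] Module.End ℂ Spinor where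
  toFun A := (1 / 2 : ℂ) • ∑ a, cliff (A *ᵥ Pi.single a 1) * cliff (Pi.single a.swap 1)
  map_add' A B := by simp only [Matrix.add_mulVec, map_add, add_mul, Finset.sum_add_distrib, smul_add]
  map_smul' c A := by
    simp only [Matrix.smul_mulVec, map_smul, smul_mul_assoc, ← Finset.smul_sum, RingHom.id_apply]
    rw [smul_comm]

/-- `so(10, ℂ)`, the orthogonal Lie algebra of the symmetric form `pair`. -/
noncomputable abbrev so10 : LieSubalgebra ℂ (Matrix (Fin 5 ⊕ Fin 5) (Fin 5 ⊕ Fin 5) ℂ) :=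
  LieAlgebra.Orthogonal.typeD (Fin 5) ℂ

theorem pair_skew (A : so10) (v w : Vec) : pair (A.1 *ᵥ v) w = -pair v (A.1 *ᵥ w) := by
  have h : A.1ᵀ * LieAlgebra.Orthogonal.JD (Fin 5) ℂ = LieAlgebra.Orthogonal.JD (Fin 5) ℂ * (-A.1) :=
    (mem_skewAdjointMatricesSubmodule _ _).1 ((mem_skewAdjointMatricesLieSubalgebra _ _).1 A.2)
  rw [pair, Matrix.toBilin'_apply', Matrix.toBilin'_apply', ← Matrix.vecMul_transpose,
    ← Matrix.dotProduct_mulVec, Matrix.mulVec_mulVec, h, ← Matrix.mulVec_mulVec, Matrix.neg_mulVec,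
    Matrix.mulVec_neg, dotProduct_neg]

theorem vec_eq (v : Vec) : v = ∑ a, v a • Pi.single a (1 : ℂ) := by
  simpa using (pi_eq_sum_univ' v)

theorem pair_single_left (a : Fin 5 ⊕ Fin 5) (v : Vec) : pair (Pi.single a 1) v = v a.swap := by
  simp [pair_apply, Pi.single_apply]

theorem pair_comm (v w : Vec) : pair v w = pair w v := by
  rw [pair_apply, pair_apply, ← (Equiv.sumComm (Fin 5) (Fin 5)).sum_comp]
  simp [mul_comm]

theorem pair_ext {v w : Vec} (h : ∀ u, pair v u = pair w u) : v = w := by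
  ext a
  have := h (Pi.single a.swap 1)
  rwa [pair_comm, pair_comm w, pair_single_left, pair_single_left, Sum.swap_swap] at this

theorem spinMat_commutator (A : so10) (v : Vec) :
    spinMat A.1 * cliff v - cliff v * spinMat A.1 = cliff (A.1 *ᵥ v) := by
  have key : ∀ x y : Vec, cliff x * cliff y * cliff v - cliff v * (cliff x * cliff y) =
      pair y v • cliff x - pair x v • cliff y := by
    intro x y
    have h1 := cliff_anticomm y v
    have h2 := cliff_anticomm x v
    have e1 : cliff y * cliff v = pair y v • 1 - cliff v * cliff y := eq_sub_of_add_eq h1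
    have e2 : cliff v * cliff x = pair x v • 1 - cliff x * cliff v := eq_sub_of_add_eq' h2
    rw [mul_assoc, e1, ← mul_assoc, e2, mul_sub, sub_mul, mul_smul_comm, smul_mul_assoc, mul_one,
      one_mul, mul_assoc]
    abel
  have e1 : ∑ a, pair (Pi.single a.swap 1) v • cliff (A.1 *ᵥ Pi.single a 1) = cliff (A.1 *ᵥ v) := by
    conv_rhs => rw [vec_eq v]
    simp only [pair_single_left, Sum.swap_swap, Matrix.mulVec_sum, Matrix.mulVec_smul, map_sum,
      map_smul]
  have e2 : ∑ a, pair (A.1 *ᵥ Pi.single a 1) v • cliff (Pi.single a.swap 1) =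
      - cliff (A.1 *ᵥ v) := by
    conv_rhs => rw [vec_eq (A.1 *ᵥ v)]
    rw [← (Equiv.sumComm (Fin 5) (Fin 5)).sum_comp]
    simp only [pair_skew, pair_single_left, Equiv.sumComm_apply, Sum.swap_swap, map_sum, map_smul,
      neg_smul, Finset.sum_neg_distrib]
  simp only [spinMat, LinearMap.coe_mk, AddHom.coe_mk, smul_mul_assoc, mul_smul_comm,
    Finset.sum_mul, Finset.mul_sum, ← smul_sub, ← Finset.sum_sub_distrib, key]
  rw [Finset.sum_sub_distrib, e1, e2, sub_neg_eq_add, ← two_smul ℂ, smul_smul]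
  norm_num

theorem spinMat_lie (A B : so10) :
    spinMat ⁅A, B⁆.1 = spinMat A.1 * spinMat B.1 - spinMat B.1 * spinMat A.1 := by
  have key : ∀ x y : Vec, spinMat A.1 * (cliff x * cliff y) - cliff x * cliff y * spinMat A.1 =
      cliff (A.1 *ᵥ x) * cliff y + cliff x * cliff (A.1 *ᵥ y) := by
    intro x y
    rw [← spinMat_commutator A x, ← spinMat_commutator A y]
    noncomm_ring
  have e : ∑ a, cliff (B.1 *ᵥ Pi.single a 1) * cliff (A.1 *ᵥ Pi.single a.swap 1) =
      - ∑ a, cliff ((B.1 * A.1) *ᵥ Pi.single a 1) * cliff (Pi.single a.swap 1) := by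
    have h1 : ∀ a : Fin 5 ⊕ Fin 5, cliff (A.1 *ᵥ Pi.single a.swap 1) =
        - ∑ b, (A.1 a b) • cliff (Pi.single b.swap 1) := by
      intro a
      rw [vec_eq (A.1 *ᵥ Pi.single a.swap 1), ← (Equiv.sumComm (Fin 5) (Fin 5)).sum_comp, map_sum,
        ← Finset.sum_neg_distrib]
      refine Finset.sum_congr rfl fun b _ => ?_
      rw [map_smul, ← neg_smul]
      congr 1
      have h := pair_skew A (Pi.single a.swap 1) (Pi.single b 1)
      rw [pair_comm, pair_single_left, pair_single_left, Sum.swap_swap] at h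
      simpa using h
    have h2 : ∀ b : Fin 5 ⊕ Fin 5, cliff ((B.1 * A.1) *ᵥ Pi.single b 1) =
        ∑ a, A.1 a b • cliff (B.1 *ᵥ Pi.single a 1) := by
      intro b
      rw [← Matrix.mulVec_mulVec, vec_eq (A.1 *ᵥ Pi.single b 1), Matrix.mulVec_sum, map_sum]
      simp [Matrix.mulVec_smul]
    simp only [h1, h2, mul_neg, Finset.sum_neg_distrib, Finset.mul_sum, Finset.sum_mul,
      smul_mul_assoc, mul_smul_comm]
    rw [Finset.sum_comm]
  have hb : spinMat ⁅A, B⁆.1 = (1 / 2 : ℂ) • ∑ a, (cliff (A.1 *ᵥ B.1 *ᵥ Pi.single a 1) *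
      cliff (Pi.single a.swap 1) - cliff ((B.1 * A.1) *ᵥ Pi.single a 1) *
      cliff (Pi.single a.swap 1)) := by
    simp only [spinMat, LinearMap.coe_mk, AddHom.coe_mk, LieSubalgebra.coe_bracket,
      Ring.lie_def, Matrix.sub_mulVec, map_sub, sub_mul, Matrix.mulVec_mulVec,
      Finset.sum_sub_distrib, smul_sub]
  rw [hb, Finset.sum_sub_distrib, sub_eq_add_neg, ← e, ← Finset.sum_add_distrib]
  simp only [← key]
  have hB : spinMat B.1 = (1 / 2 : ℂ) •
      ∑ a, cliff (B.1 *ᵥ Pi.single a 1) * cliff (Pi.single a.swap 1) := rfl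
  rw [hB]
  simp only [Finset.sum_sub_distrib, ← Finset.mul_sum, ← Finset.sum_mul, smul_sub, smul_mul_assoc,
    mul_smul_comm]

/-- The coefficient of `e₁ ∧ ⋯ ∧ e₅`. -/
noncomputable def berezin : Spinor →ₗ[ℂ] ℂ :=
  ExteriorAlgebra.liftAlternating (Pi.single 5 Matrix.detRowAlternating)

theorem berezin_ιMulti (k : ℕ) (hk : k ≠ 5) (v : Fin k → V) :
    berezin (ExteriorAlgebra.ιMulti ℂ k v) = 0 := by
  rw [berezin, ExteriorAlgebra.liftAlternating_apply_ιMulti, Pi.single_eq_of_ne hk]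
  rfl

theorem berezin_pow (k : ℕ) (hk : k ≠ 5) (x : Spinor) (hx : x ∈ ⋀[ℂ]^k V) : berezin x = 0 := by
  rw [← ExteriorAlgebra.ιMulti_span_fixedDegree] at hx
  induction hx using Submodule.span_induction with
  | mem x h => obtain ⟨v, rfl⟩ := h; exact berezin_ιMulti k hk v
  | zero => exact map_zero _
  | add x y _ _ hx hy => rw [map_add, hx, hy, add_zero]
  | smul c x _ hx => rw [map_smul, hx, smul_zero]

theorem berezin_reverse (x : Spinor) : berezin (CliffordAlgebra.reverse x) = berezin x := by
  suffices h : berezin ∘ₗ CliffordAlgebra.reverse = berezin from LinearMap.congr_fun h x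
  ext k v
  change berezin (CliffordAlgebra.reverse (ExteriorAlgebra.ιMulti ℂ k v)) =
    berezin (ExteriorAlgebra.ιMulti ℂ k v)
  have h : CliffordAlgebra.reverse (ExteriorAlgebra.ιMulti ℂ k v) =
      ExteriorAlgebra.ιMulti ℂ k (v ∘ Fin.revPerm) := by
    have h1 := CliffordAlgebra.reverse_prod_map_ι (Q := (0 : QuadraticForm ℂ V)) (List.ofFn v)
    rw [List.map_ofFn] at h1
    rw [ExteriorAlgebra.ιMulti_apply, ExteriorAlgebra.ιMulti_apply]
    refine h1.trans (congrArg List.prod ?_)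
    apply List.ext_getElem
    · simp
    · intro i h1 h2
      simp only [List.getElem_reverse, List.getElem_ofFn, Function.comp_apply, List.length_ofFn]
      congr 2
      apply Fin.ext
      simp [Fin.val_rev]
      omega
  rw [h, AlternatingMap.map_perm]
  by_cases hk : k = 5
  · subst hk
    rw [show Equiv.Perm.sign (Fin.revPerm : Equiv.Perm (Fin 5)) = 1 by decide, one_smul]
  · rw [Units.smul_def, map_zsmul, berezin_ιMulti k hk, smul_zero]

theorem contract_ι_mul (d : Module.Dual ℂ V) (a : V) (y : Spinor) :
      CliffordAlgebra.contractLeft d (ExteriorAlgebra.ι ℂ a * y) =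
        d a • y - ExteriorAlgebra.ι ℂ a * CliffordAlgebra.contractLeft d y :=
    CliffordAlgebra.contractLeft_ι_mul d a y

theorem contract_ιMulti_mem (d : Module.Dual ℂ V) (k : ℕ) (v : Fin (k + 1) → V) :
    CliffordAlgebra.contractLeft d (ExteriorAlgebra.ιMulti ℂ (k + 1) v) ∈ ⋀[ℂ]^k V := by
  induction k with
  | zero => 
    rw [ExteriorAlgebra.ιMulti_succ_apply, contract_ι_mul]
    simp [Algebra.algebraMap_eq_smul_one]
  | succ k ih =>
    rw [ExteriorAlgebra.ιMulti_succ_apply, contract_ι_mul]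
    refine sub_mem (Submodule.smul_mem _ _ (ExteriorAlgebra.ιMulti_range ℂ _ ⟨_, rfl⟩)) ?_
    rw [ExteriorAlgebra.exteriorPower, pow_succ']
    exact Submodule.mul_mem_mul ⟨_, rfl⟩ (ih _)

theorem berezin_contract (d : Module.Dual ℂ V) (x : Spinor) :
    berezin (CliffordAlgebra.contractLeft d x) = 0 := by
  suffices h : berezin ∘ₗ CliffordAlgebra.contractLeft d = 0 from LinearMap.congr_fun h x
  ext k v
  change berezin (CliffordAlgebra.contractLeft d (ExteriorAlgebra.ιMulti ℂ k v)) = 0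
  rcases k with _ | k
  · simp [ExteriorAlgebra.ιMulti_zero_apply]
  · by_cases hk : k = 5
    · subst hk
      have h0 : ExteriorAlgebra.ιMulti ℂ (5 + 1) v = 0 := by
        apply AlternatingMap.map_linearDependent
        intro hv
        simpa using hv.fintype_card_le_finrank
      rw [h0, map_zero, map_zero]
    · exact berezin_pow k hk _ (contract_ιMulti_mem d k v)

/-- The pairing of spinors: the top-degree coefficient of `sᵗ ∧ t`, with `sᵗ` the reversal of `s`. -/
noncomputable def spinForm : Spinor →ₗ[ℂ] Spinor →ₗ[ℂ] ℂ :=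
  (LinearMap.mul ℂ Spinor ∘ₗ CliffordAlgebra.reverse).compr₂ berezin

theorem spinForm_apply (s t : Spinor) :
    spinForm s t = berezin (CliffordAlgebra.reverse s * t) := rfl

theorem spinForm_comm (s t : Spinor) : spinForm s t = spinForm t s := by
  rw [spinForm_apply, spinForm_apply, ← berezin_reverse, CliffordAlgebra.reverse.map_mul,
    CliffordAlgebra.reverse_reverse]

theorem spinForm_cliff (v : Vec) (s t : Spinor) :
    spinForm (cliff v s) t = spinForm s (cliff v t) := by
  have h2 : ∀ d : Module.Dual ℂ V, spinForm (CliffordAlgebra.contractLeft d s) t =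
      spinForm s (CliffordAlgebra.contractLeft d t) := by
    intro d
    induction s using CliffordAlgebra.left_induction generalizing t with
    | algebraMap r =>
      simp only [spinForm_apply, CliffordAlgebra.contractLeft_algebraMap, map_zero, zero_mul,
        CliffordAlgebra.reverse.commutes, ← Algebra.smul_def, map_smul, berezin_contract, smul_zero, LinearMap.zero_apply]
    | add x y hx hy => simp only [map_add, LinearMap.add_apply, hx, hy]
    | ι_mul x a hx =>
      have h := hx (ExteriorAlgebra.ι ℂ a * t)
      rw [contract_ι_mul] at h
      simp only [map_sub, map_smul] at h
      rw [CliffordAlgebra.contractLeft_ι_mul]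
      simp only [spinForm_apply, map_sub, map_smul, LinearMap.sub_apply, LinearMap.smul_apply,
        CliffordAlgebra.reverse.map_mul, CliffordAlgebra.reverse_ι, sub_mul, smul_mul_assoc] at h ⊢
      rw [mul_assoc, mul_assoc]
      change _ = berezin (_ * (ExteriorAlgebra.ι ℂ a * _))
      change _ - berezin (_ * (ExteriorAlgebra.ι ℂ a * _)) = _
      rw [h]; ring
  rw [cliff_apply, cliff_apply, map_add, map_add, LinearMap.add_apply, h2]
  congr 1
  rw [spinForm_apply, spinForm_apply, CliffordAlgebra.reverse.map_mul, mul_assoc]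
  congr 2
  congr 1
  exact CliffordAlgebra.reverse_ι _

/-- The vector `Γ(s, t)` with `⟨Γ(s, t), v⟩ = (s, v · t)` for all vectors `v`, see `pair_gammaMap`. -/
noncomputable def gammaMap : Spinor →ₗ[ℂ] Spinor →ₗ[ℂ] Vec :=
  LinearMap.mk₂ ℂ (fun s t a => spinForm s (cliff (Pi.single a.swap 1) t))
    (fun _ _ _ => by ext; simp) (fun _ _ _ => by ext; simp)
    (fun _ _ _ => by ext; simp) (fun _ _ _ => by ext; simp)

theorem pair_gammaMap (s t : Spinor) (v : Vec) :
    pair (gammaMap s t) v = spinForm s (cliff v t) := by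
  conv_rhs => rw [vec_eq v, ← (Equiv.sumComm (Fin 5) (Fin 5)).sum_comp]
  rw [pair_apply]
  simp [gammaMap, mul_comm]

theorem gammaMap_comm (s t : Spinor) : gammaMap s t = gammaMap t s := by
  refine pair_ext fun v => ?_
  rw [pair_gammaMap, pair_gammaMap, ← spinForm_cliff, spinForm_comm]

theorem spinForm_spinMat (A : so10) (s t : Spinor) :
    spinForm (spinMat A.1 s) t = - spinForm s (spinMat A.1 t) := by
  have h1 : ∀ x y : Vec, spinForm ((cliff x * cliff y) s) t =
      pair x y * spinForm s t - spinForm s ((cliff x * cliff y) t) := by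
    intro x y
    have h := LinearMap.congr_fun (cliff_anticomm x y) t
    rw [LinearMap.add_apply, ← eq_sub_iff_add_eq'] at h
    rw [Module.End.mul_apply, spinForm_cliff, spinForm_cliff, ← Module.End.mul_apply, h, map_sub]
    simp
  have tr1 : ∑ a, pair (A.1 *ᵥ Pi.single a 1) (Pi.single a.swap 1) = ∑ a, A.1 a a := by
    refine Finset.sum_congr rfl fun a _ => ?_
    rw [pair_comm, pair_single_left]
    simp
  have tr2 : ∑ a, pair (A.1 *ᵥ Pi.single a 1) (Pi.single a.swap 1) = - ∑ a, A.1 a a := by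
    rw [← (Equiv.sumComm (Fin 5) (Fin 5)).sum_comp (fun a => A.1 a a), ← Finset.sum_neg_distrib]
    refine Finset.sum_congr rfl fun a _ => ?_
    rw [pair_skew, pair_single_left]
    simp
  have tr : ∑ a, pair (A.1 *ᵥ Pi.single a 1) (Pi.single a.swap 1) = 0 := by
    rw [tr1]
    exact self_eq_neg.1 (tr1.symm.trans tr2)
  simp only [spinMat, LinearMap.coe_mk, AddHom.coe_mk, LinearMap.smul_apply, LinearMap.sum_apply,
    map_smul, map_sum, h1, Finset.sum_sub_distrib, ← Finset.sum_mul, tr,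
    zero_mul, zero_sub, smul_neg]

theorem gammaMap_equivariant (A : so10) (s t : Spinor) :
    A.1 *ᵥ gammaMap s t = gammaMap (spinMat A.1 s) t + gammaMap s (spinMat A.1 t) := by
  refine pair_ext fun v => ?_
  have h := LinearMap.congr_fun (spinMat_commutator A v) t
  simp only [LinearMap.sub_apply, Module.End.mul_apply] at h
  rw [map_add, LinearMap.add_apply, pair_skew, pair_gammaMap, pair_gammaMap, pair_gammaMap,
    spinForm_spinMat, ← h, map_sub]
  ring

/-- The positive spin representation `S₊`: the even part of the exterior algebra of `V`. -/
noncomputable abbrev SPlus : Submodule ℂ Spinor :=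
  CliffordAlgebra.evenOdd (0 : QuadraticForm ℂ V) 0

theorem mem_SPlus_iff (x : Spinor) : x ∈ SPlus ↔ CliffordAlgebra.involute x = x := by
  refine ⟨fun h => CliffordAlgebra.involute_eq_of_mem_even h, fun h => ?_⟩
  have hx : x ∈ SPlus ⊔ CliffordAlgebra.evenOdd (0 : QuadraticForm ℂ V) 1 := by
    rw [(CliffordAlgebra.evenOdd_isCompl (0 : QuadraticForm ℂ V)).sup_eq_top]
    trivial
  obtain ⟨y, hy, z, hz, rfl⟩ := Submodule.mem_sup.1 hx
  rw [map_add, CliffordAlgebra.involute_eq_of_mem_even hy,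
    CliffordAlgebra.involute_eq_of_mem_odd hz, add_right_inj] at h
  have h2 : (2 : ℂ) • z = 0 := by rw [two_smul]; exact eq_neg_iff_add_eq_zero.1 h.symm
  rw [(smul_eq_zero.1 h2).resolve_left two_ne_zero, add_zero]
  exact hy

theorem involute_cliff (v : Vec) (x : Spinor) :
    CliffordAlgebra.involute (cliff v x) = - cliff v (CliffordAlgebra.involute x) := by
  have h : ∀ d : Module.Dual ℂ V, CliffordAlgebra.involute (CliffordAlgebra.contractLeft d x) =
      - CliffordAlgebra.contractLeft d (CliffordAlgebra.involute x) := by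
    intro d
    induction x using CliffordAlgebra.left_induction with
    | algebraMap r => simp
    | add x y hx hy => rw [map_add, map_add, hx, hy, map_add, map_add, neg_add]
    | ι_mul x a hx =>
      rw [CliffordAlgebra.contractLeft_ι_mul, map_sub, map_smul, map_mul, map_mul, hx,
        CliffordAlgebra.involute_ι, neg_mul, neg_mul, map_neg, CliffordAlgebra.contractLeft_ι_mul]
      simp
  have h2 : CliffordAlgebra.involute (ExteriorAlgebra.ι ℂ (v ∘ Sum.inl)) =
    - ExteriorAlgebra.ι ℂ (v ∘ Sum.inl) := CliffordAlgebra.involute_ι _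
  rw [cliff_apply, cliff_apply, map_add, map_mul, h, h2, neg_mul, neg_add]

theorem spinMat_mem (A : Matrix (Fin 5 ⊕ Fin 5) (Fin 5 ⊕ Fin 5) ℂ) (x : Spinor) (hx : x ∈ SPlus) :
    spinMat A x ∈ SPlus := by
  rw [mem_SPlus_iff] at *
  simp only [spinMat, LinearMap.coe_mk, AddHom.coe_mk, LinearMap.smul_apply, LinearMap.sum_apply,
    map_smul, map_sum, Module.End.mul_apply, involute_cliff, map_neg, neg_neg, hx]

/-- The spin representation of `so(10)` on `S₊`. -/
noncomputable def spin : so10 →ₗ[ℂ] Module.End ℂ SPlus where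
  toFun A := (spinMat A.1).restrict (spinMat_mem A.1)
  map_add' A B := by ext x; simp [LinearMap.restrict_apply]
  map_smul' c A := by ext x; simp [LinearMap.restrict_apply]

theorem coe_spin (A : so10) (s : SPlus) : (spin A s : Spinor) = spinMat A.1 s := rfl

theorem spin_lie (A B : so10) (s : SPlus) :
    spin A (spin B s) = spin ⁅A, B⁆ s + spin B (spin A s) := by
  ext1
  have h := LinearMap.congr_fun (spinMat_lie A B) s
  simp only [LinearMap.sub_apply, Module.End.mul_apply] at h
  rw [Submodule.coe_add, coe_spin, coe_spin, coe_spin, coe_spin, coe_spin, h, sub_add_cancel]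

/-- The `so(10)`-equivariant symmetric map `Γ⁺ : Sym² S₊ → ℂ¹⁰` (unique up to a scalar, being the
projection of `Sym² S₊` to its summand `ℂ¹⁰`). -/
noncomputable def gammaPlus : SPlus →ₗ[ℂ] SPlus →ₗ[ℂ] Vec :=
  gammaMap.domRestrict₁₂ SPlus SPlus

/-- The space `ℂ²`, with the bilinear inner product `dotProduct` and the orthonormal basis `e`. -/
abbrev C2 : Type := Fin 2 → ℂ

/-- The orthonormal basis of `ℂ²`: `e 0` and `e 1` are the vectors usually written `e₁` and `e₂`. -/
abbrev e (i : Fin 2) : C2 := Pi.single i 1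

/-- The bracket `[ψ₁ ⊗ α, ψ₂ ⊗ β] = Γ⁺(ψ₁, ψ₂) ⟨α, β⟩` of supertranslations. -/
noncomputable def superTranslation : (SPlus ⊗[ℂ] C2) →ₗ[ℂ] (SPlus ⊗[ℂ] C2) →ₗ[ℂ] Vec :=
  (TensorProduct.map₂ gammaPlus (dotProductBilin ℂ ℂ)).compr₂ (TensorProduct.rid ℂ Vec).toLinearMap

theorem superTranslation_tmul (s t : SPlus) (a b : C2) :
    superTranslation (s ⊗ₜ a) (t ⊗ₜ b) = (a ⬝ᵥ b) • gammaPlus s t := by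
  simp [superTranslation, dotProductBilin]

theorem superTranslation_comm (x y : SPlus ⊗[ℂ] C2) :
    superTranslation x y = superTranslation y x := by
  suffices h : superTranslation = superTranslation.flip from
    LinearMap.congr_fun (LinearMap.congr_fun h x) y
  refine TensorProduct.ext' fun s a => TensorProduct.ext' fun t b => ?_
  rw [LinearMap.flip_apply, superTranslation_tmul, superTranslation_tmul, dotProduct_comm]
  exact congrArg _ (gammaMap_comm _ _)

theorem superTranslation_equivariant (A : so10) (x y : SPlus ⊗[ℂ] C2) :
    A.1 *ᵥ superTranslation x y = superTranslation ((spin A).rTensor C2 x) y +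
      superTranslation x ((spin A).rTensor C2 y) := by
  induction x with
  | zero => simp
  | add x x' hx hx' =>
    simp only [map_add, LinearMap.add_apply, Matrix.mulVec_add, hx, hx']; abel
  | tmul s a =>
    induction y with
    | zero => simp
    | add y y' hy hy' => simp only [map_add, Matrix.mulVec_add, hy, hy']; abel
    | tmul t b =>
      rw [LinearMap.rTensor_tmul, LinearMap.rTensor_tmul, superTranslation_tmul,
        superTranslation_tmul, superTranslation_tmul, Matrix.mulVec_smul, ← smul_add]
      exact congrArg _ (gammaMap_equivariant A s t)

/-- The 10-dimensional `𝒩 = (2,0)` supersymmetry algebra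
`siso_IIB = so(10) ⋉ (ℂ¹⁰ ⊕ Π (S₊ ⊗ ℂ²))`. -/
noncomputable def siso : LieSuperalgebra (so10 × Vec) (SPlus ⊗[ℂ] C2) where
  b00 := LinearMap.mk₂ ℂ (fun x y => (⁅x.1, y.1⁆, x.1.1 *ᵥ y.2 - y.1.1 *ᵥ x.2))
    (fun x y z => by
      ext1
      · simp
      · simp only [Prod.fst_add, Prod.snd_add, AddMemClass.coe_add,
          Matrix.add_mulVec, Matrix.mulVec_add]
        abel)
    (fun c x y => by
      ext1
      · simp
      · simp [Matrix.smul_mulVec, Matrix.mulVec_smul, smul_sub])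
    (fun x y z => by
      ext1
      · simp
      · simp only [Prod.fst_add, Prod.snd_add, AddMemClass.coe_add,
          Matrix.add_mulVec, Matrix.mulVec_add]
        abel)
    (fun c x y => by
      ext1
      · simp
      · simp [Matrix.smul_mulVec, Matrix.mulVec_smul, smul_sub])
  b01 := LinearMap.rTensorHom C2 ∘ₗ spin ∘ₗ LinearMap.fst ℂ so10 Vec
  b11 := superTranslation.compr₂ (LinearMap.inr ℂ so10 Vec)
  b00_self x := by simp
  b11_comm a b := by simp [superTranslation_comm a b]
  jacobi000 x y z := by
    ext1
    · simp
    · simp only [LinearMap.mk₂_apply, LieSubalgebra.coe_bracket, Ring.lie_def, Prod.snd_add,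
        Matrix.sub_mulVec, Matrix.mulVec_sub, Matrix.mulVec_mulVec]
      abel
  jacobi001 x y a := by
    induction a with
    | zero => simp
    | add a b ha hb => simp only [map_add, ha, hb]; abel
    | tmul s a => simp [← TensorProduct.add_tmul, spin_lie x.1 y.1 s]
  jacobi011 x a b := by
    ext1
    · simp
    · simpa using superTranslation_equivariant x.1 a b
  jacobi111 a b c := by simp

/-- `sl(5, ℂ)`. -/
abbrev sl5 : LieSubalgebra ℂ (Matrix (Fin 5) (Fin 5) ℂ) := LieAlgebra.SpecialLinear.sl (Fin 5) ℂ

/-- The inclusion `sl(5) ⊂ so(10)`, through the action of `sl(5)` on `ℂ¹⁰ = V ⊕ V*`. -/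
noncomputable def slToSo : sl5 →ₗ[ℂ] so10 where
  toFun A := ⟨Matrix.fromBlocks A.1 0 0 (-A.1ᵀ), by
    refine (mem_skewAdjointMatricesLieSubalgebra _ _).2 ((mem_skewAdjointMatricesSubmodule _ _).2 ?_)
    change (Matrix.fromBlocks A.1 0 0 (-A.1ᵀ))ᵀ * Matrix.fromBlocks 0 1 1 0 =
      Matrix.fromBlocks 0 1 1 0 * -Matrix.fromBlocks A.1 0 0 (-A.1ᵀ)
    simp only [Matrix.fromBlocks_transpose, Matrix.fromBlocks_neg, Matrix.fromBlocks_multiply,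
      Matrix.transpose_neg, Matrix.transpose_transpose, Matrix.transpose_zero, Matrix.mul_zero,
      Matrix.zero_mul, Matrix.mul_one, Matrix.one_mul, neg_neg, neg_zero, add_zero, zero_add]⟩
  map_add' A B := by
    refine Subtype.ext ?_
    change Matrix.fromBlocks (A.1 + B.1) 0 0 (-(A.1 + B.1)ᵀ) =
      Matrix.fromBlocks A.1 0 0 (-A.1ᵀ) + Matrix.fromBlocks B.1 0 0 (-B.1ᵀ)
    simp only [Matrix.fromBlocks_add, Matrix.transpose_add, neg_add, add_zero]
  map_smul' c A := by
    refine Subtype.ext ?_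
    change Matrix.fromBlocks (c • A.1) 0 0 (-(c • A.1)ᵀ) = c • Matrix.fromBlocks A.1 0 0 (-A.1ᵀ)
    simp only [Matrix.fromBlocks_smul, Matrix.transpose_smul, smul_neg, smul_zero]

/-- The action of `sl(5)` on `⋀ᵏ V`. -/
noncomputable def wedgeAct (k : ℕ) (A : sl5) : ⋀[ℂ]^k V →ₗ[ℂ] ⋀[ℂ]^k V :=
  extAct k A.1.mulVecLin

/-- The action of `sl(5)` on `V*`. -/
noncomputable def dualAct (A : sl5) : Module.Dual ℂ V →ₗ[ℂ] Module.Dual ℂ V :=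
  -LinearMap.dualMap A.1.mulVecLin

end IIB

open IIB

/-!
Each invariant element of `S₊ = ⋀^even V` is a constant `ψ = c`, because `S₊ = ℂ ⊕ ⋀² V ⊕ ⋀⁴ V` as a
representation of `sl(5)` and neither `⋀² V` nor `⋀⁴ V ≅ V*` has invariants
(`exists_eq_smul_one_of_invariant`). The isomorphism `V* ≅ ⋀⁴ V` is contraction with the volume
element; it is equivariant since `sl(5)` acts on spinors by derivations and annihilates the volume
element (`spin_slToSo_spinorEquiv`).

For a nonzero constant `ψ` the complex is explicit.

* An element of `so(10)` has blocks `A : V → V`, `B : V* → V`, `C : V → V*`, with `B` and `C` skew,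
  and it sends `1` to a multiple of `tr A` plus the bivector of `B`. Hence the stabilizer of `ψ`
  consists of the pairs of a traceless `A` and a skew form `C` (`mem_range_stabToSo_iff`), and the
  orbit of `ψ` has tangent space `ℂ ⊕ ⋀² V` (`exists_spinMat_one_eq`). Skew forms on `V` are
  identified with `⋀³ V` by `τ ↦ ∫ u ∧ v ∧ τ` (`skewMatrix`), equivariantly because the Berezin
  integral is invariant (`skewMatrix_wedgeAct`).
* `Γ⁺(ψ, -)` is the projection of `S₊` onto `V* ⊂ ℂ¹⁰`, up to the factor `c`
  (`gammaPlus_spinorEquiv`).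

So the even cocycles are the stabilizer and all translations, and the even coboundaries are the
translations in `V*`. The odd cocycles are `(ℂ ⊕ ⋀² V) ⊗ e₁ ⊕ S₊ ⊗ e₂`, and the odd coboundaries are
exactly the first summand. The representatives of the classes multiply as in the supersymmetry
algebra, up to translations in `V*`; in particular `⋀³ V` maps `V` to `V*`, so that it commutes with
`V` in cohomology. The brackets of odd elements and those with a translation are translations, which
gives the semidirect product.
-/

/-! ### Cohomology from representatives -/

namespace LieSuperalgebra

variable {L₀ L₁ M N : Type*} [AddCommGroup L₀] [Module ℂ L₀] [AddCommGroup L₁] [Module ℂ L₁]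
  [AddCommGroup M] [Module ℂ M] [AddCommGroup N] [Module ℂ N]
variable (g : LieSuperalgebra L₀ L₁) (Q : L₁)

theorem mk₀_eq_mk₀ {x y : L₀} (hx : x ∈ g.Z₀ Q) (hy : y ∈ g.Z₀ Q) (a : L₁)
    (h : g.b11 Q a = x - y) : g.mk₀ Q x hx = g.mk₀ Q y hy := by
  rw [← sub_eq_zero, ← map_sub]
  exact g.mk₀_eq_zero Q (sub_mem hx hy) a h

theorem mk₁_eq_mk₁ {a b : L₁} (ha : a ∈ g.Z₁ Q) (hb : b ∈ g.Z₁ Q) (x : L₀)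
    (h : -g.b01 x Q = a - b) : g.mk₁ Q a ha = g.mk₁ Q b hb := by
  rw [← sub_eq_zero, ← map_sub]
  exact g.mk₁_eq_zero Q (sub_mem ha hb) x h

/-- The isomorphism from a space of even cocycles to the even cohomology, if these cocycles contain
no nonzero coboundary and represent every class. -/
noncomputable def equivH₀ (f : M →ₗ[ℂ] L₀) (hf : ∀ m, f m ∈ g.Z₀ Q)
    (hinj : ∀ m a, g.b11 Q a = f m → m = 0)
    (hsurj : ∀ x ∈ g.Z₀ Q, ∃ m a, g.b11 Q a = f m - x) : M ≃ₗ[ℂ] g.H₀ Q :=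
  LinearEquiv.ofBijective ((g.B₀ Q).mkQ ∘ₗ f.codRestrict (g.Z₀ Q) hf) <| by
    constructor
    · rw [injective_iff_map_eq_zero]
      intro m h
      rw [LinearMap.comp_apply, Submodule.mkQ_apply, Submodule.Quotient.mk_eq_zero] at h
      obtain ⟨a, ha⟩ := h
      exact hinj m a ha
    · intro x
      obtain ⟨⟨x, hx⟩, rfl⟩ := Submodule.mkQ_surjective _ x
      obtain ⟨m, a, h⟩ := hsurj x hx
      exact ⟨m, g.mk₀_eq_mk₀ Q (hf m) hx a h⟩

theorem equivH₀_apply (f : M →ₗ[ℂ] L₀) (hf : ∀ m, f m ∈ g.Z₀ Q)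
    (hinj : ∀ m a, g.b11 Q a = f m → m = 0)
    (hsurj : ∀ x ∈ g.Z₀ Q, ∃ m a, g.b11 Q a = f m - x) (m : M) :
    g.equivH₀ Q f hf hinj hsurj m = g.mk₀ Q (f m) (hf m) := rfl

/-- The isomorphism from a space of odd cocycles to the odd cohomology, if these cocycles contain
no nonzero coboundary and represent every class. -/
noncomputable def equivH₁ (f : M →ₗ[ℂ] L₁) (hf : ∀ m, f m ∈ g.Z₁ Q)
    (hinj : ∀ m x, -g.b01 x Q = f m → m = 0)
    (hsurj : ∀ a ∈ g.Z₁ Q, ∃ m x, -g.b01 x Q = f m - a) : M ≃ₗ[ℂ] g.H₁ Q :=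
  LinearEquiv.ofBijective ((g.B₁ Q).mkQ ∘ₗ f.codRestrict (g.Z₁ Q) hf) <| by
    constructor
    · rw [injective_iff_map_eq_zero]
      intro m h
      rw [LinearMap.comp_apply, Submodule.mkQ_apply, Submodule.Quotient.mk_eq_zero] at h
      obtain ⟨x, hx⟩ := h
      exact hinj m x hx
    · intro a
      obtain ⟨⟨a, ha⟩, rfl⟩ := Submodule.mkQ_surjective _ a
      obtain ⟨m, x, h⟩ := hsurj a ha
      exact ⟨m, g.mk₁_eq_mk₁ Q (hf m) ha x h⟩

theorem equivH₁_apply (f : M →ₗ[ℂ] L₁) (hf : ∀ m, f m ∈ g.Z₁ Q)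
    (hinj : ∀ m x, -g.b01 x Q = f m → m = 0)
    (hsurj : ∀ a ∈ g.Z₁ Q, ∃ m x, -g.b01 x Q = f m - a) (m : M) :
    g.equivH₁ Q f hf hinj hsurj m = g.mk₁ Q (f m) (hf m) := rfl

section Brackets

variable {f₀ : M →ₗ[ℂ] L₀} {hf₀ : ∀ m, f₀ m ∈ g.Z₀ Q} {hinj₀ : ∀ m a, g.b11 Q a = f₀ m → m = 0}
  {hsurj₀ : ∀ x ∈ g.Z₀ Q, ∃ m a, g.b11 Q a = f₀ m - x}
  {f₁ : N →ₗ[ℂ] L₁} {hf₁ : ∀ n, f₁ n ∈ g.Z₁ Q} {hinj₁ : ∀ n x, -g.b01 x Q = f₁ n → n = 0}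
  {hsurj₁ : ∀ a ∈ g.Z₁ Q, ∃ n x, -g.b01 x Q = f₁ n - a}

theorem cohomology_b00_equiv (m m' k : M) (h : ∃ a, g.b11 Q a = g.b00 (f₀ m) (f₀ m') - f₀ k) :
    (g.cohomology Q).b00 (g.equivH₀ Q f₀ hf₀ hinj₀ hsurj₀ m) (g.equivH₀ Q f₀ hf₀ hinj₀ hsurj₀ m') =
      g.equivH₀ Q f₀ hf₀ hinj₀ hsurj₀ k := by
  obtain ⟨a, ha⟩ := h
  exact g.mk₀_eq_mk₀ Q (g.b00_mem Q (hf₀ m) (hf₀ m')) (hf₀ k) a ha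

theorem cohomology_b01_equiv (m : M) (n k : N) (h : g.b01 (f₀ m) (f₁ n) = f₁ k) :
    (g.cohomology Q).b01 (g.equivH₀ Q f₀ hf₀ hinj₀ hsurj₀ m) (g.equivH₁ Q f₁ hf₁ hinj₁ hsurj₁ n) =
      g.equivH₁ Q f₁ hf₁ hinj₁ hsurj₁ k :=
  g.mk₁_eq_mk₁ Q (g.b01_mem Q (hf₀ m) (hf₁ n)) (hf₁ k) 0 (by simp [h])

theorem cohomology_b11_equiv (n n' : N) (k : M)
    (h : ∃ a, g.b11 Q a = g.b11 (f₁ n) (f₁ n') - f₀ k) :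
    (g.cohomology Q).b11 (g.equivH₁ Q f₁ hf₁ hinj₁ hsurj₁ n) (g.equivH₁ Q f₁ hf₁ hinj₁ hsurj₁ n') =
      g.equivH₀ Q f₀ hf₀ hinj₀ hsurj₀ k := by
  obtain ⟨a, ha⟩ := h
  exact g.mk₀_eq_mk₀ Q (g.b11_mem Q (hf₁ n) (hf₁ n')) (hf₀ k) a ha

end Brackets

/-- A splitting of the even part as a subalgebra `M` and an ideal `N` containing all brackets of odd
elements makes the Lie superalgebra a semidirect product. -/
theorem isSemidirectProduct_of_equiv (Φ : (M × N) ≃ₗ[ℂ] L₀)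
    (hM : ∀ p q, ∃ r, g.b00 (Φ (p, 0)) (Φ (q, 0)) = Φ (r, 0))
    (hN : ∀ p v w, ∃ u, g.b00 (Φ (p, v)) (Φ (0, w)) = Φ (0, u))
    (hodd : ∀ a b, ∃ u, g.b11 a b = Φ (0, u)) :
    g.IsSemidirectProduct ((Submodule.prod ⊤ ⊥).map Φ.toLinearMap) ⊥
      ((Submodule.prod ⊥ ⊤).map Φ.toLinearMap) ⊤ where
  isSubalgebra :=
    { b00_mem := by
        rintro _ ⟨⟨p, _⟩, ⟨-, rfl⟩, rfl⟩ _ ⟨⟨q, _⟩, ⟨-, rfl⟩, rfl⟩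
        obtain ⟨r, hr⟩ := hM p q
        exact ⟨(r, 0), ⟨trivial, rfl⟩, hr.symm⟩
      b01_mem := by
        rintro x - _ rfl
        rw [map_zero]
        exact zero_mem _
      b11_mem := by
        rintro _ rfl _ -
        rw [map_zero]
        exact zero_mem _ }
  isIdeal :=
    { b00_mem := by
        rintro x _ ⟨⟨_, w⟩, ⟨rfl, -⟩, rfl⟩
        obtain ⟨⟨p, v⟩, rfl⟩ := Φ.surjective x
        obtain ⟨u, hu⟩ := hN p v w
        exact ⟨(0, u), ⟨rfl, trivial⟩, hu.symm⟩
      b01_mem := fun _ _ _ => trivial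
      b01_mem' := fun _ _ _ => trivial
      b11_mem := fun a b _ => by
        obtain ⟨u, hu⟩ := hodd a b
        exact ⟨(0, u), ⟨rfl, trivial⟩, hu.symm⟩ }
  isCompl₀ := by
    have h : IsCompl (Submodule.prod ⊤ ⊥ : Submodule ℂ (M × N)) (Submodule.prod ⊥ ⊤) := by
      constructor
      · rw [disjoint_iff, Submodule.prod_inf_prod, top_inf_eq, bot_inf_eq, Submodule.prod_bot]
      · rw [codisjoint_iff, Submodule.prod_sup_prod, top_sup_eq, bot_sup_eq, Submodule.prod_top]
    exact h.map (Submodule.orderIsoMapComap Φ)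
  isCompl₁ := isCompl_bot_top

end LieSuperalgebra

namespace IIB

open CliffordAlgebra (contractLeft)
open ExteriorAlgebra (ι ιMulti)

/-! ### The volume element and the Berezin integral -/

/-- The volume element `e₁ ∧ ⋯ ∧ e₅`. -/
noncomputable def vol : Spinor := ιMulti ℂ 5 fun i => Pi.single i 1

theorem vol_mem : vol ∈ ⋀[ℂ]^5 V := ExteriorAlgebra.ιMulti_range ℂ 5 ⟨_, rfl⟩

theorem berezin_vol : berezin vol = 1 := by
  rw [vol, berezin, ExteriorAlgebra.liftAlternating_apply_ιMulti, Pi.single_eq_same]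
  have : (fun i => Pi.single i 1 : Fin 5 → V) = (1 : Matrix (Fin 5) (Fin 5) ℂ) := by
    ext i j
    simp [Matrix.one_apply, Pi.single_apply, eq_comm]
  exact (congrArg Matrix.det this).trans Matrix.det_one

theorem exteriorPower_eq_bot {k : ℕ} (hk : 5 < k) : ⋀[ℂ]^k V = ⊥ := by
  rw [← ExteriorAlgebra.ιMulti_span_fixedDegree, Submodule.span_eq_bot]
  rintro _ ⟨v, rfl⟩
  refine AlternatingMap.map_linearDependent _ _ fun hv => ?_
  have := hv.fintype_card_le_finrank
  simp at this
  omega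

theorem ι_mul_mem {k : ℕ} (u : V) {x : Spinor} (hx : x ∈ ⋀[ℂ]^k V) :
    ι ℂ u * x ∈ ⋀[ℂ]^(k + 1) V := by
  rw [ExteriorAlgebra.exteriorPower, pow_succ']
  exact Submodule.mul_mem_mul ⟨_, rfl⟩ hx

theorem contract_mem {k : ℕ} (d : Module.Dual ℂ V) {x : Spinor} (hx : x ∈ ⋀[ℂ]^(k + 1) V) :
    contractLeft d x ∈ ⋀[ℂ]^k V := by
  rw [← ExteriorAlgebra.ιMulti_span_fixedDegree] at hx
  induction hx using Submodule.span_induction with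
  | mem x h => obtain ⟨v, rfl⟩ := h; exact contract_ιMulti_mem d k v
  | zero => rw [map_zero]; exact zero_mem _
  | add x y _ _ hx hy => rw [map_add]; exact add_mem hx hy
  | smul c x _ hx => rw [map_smul]; exact Submodule.smul_mem _ _ hx

theorem ι_mul_vol (u : V) : ι ℂ u * vol = 0 := by
  have h := ι_mul_mem u vol_mem
  rwa [exteriorPower_eq_bot (by norm_num), Submodule.mem_bot] at h

theorem ι_mul_contract_vol (d : Module.Dual ℂ V) (u : V) :
    ι ℂ u * contractLeft d vol = d u • vol := by
  have h := contract_ι_mul d u vol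
  rw [ι_mul_vol, map_zero] at h
  exact (sub_eq_zero.1 h.symm).symm

/-! ### Vectors in `V` and `V*` and the action of `sl(5)` by derivations -/

theorem cliff_inl (v : V) (x : Spinor) : cliff (Sum.elim v 0) x = ι ℂ v * x := by
  rw [cliff_apply, Sum.elim_comp_inl, Sum.elim_comp_inr, map_zero, map_zero, LinearMap.zero_apply,
    add_zero]

/-- The vector of `ℂ¹⁰ = V ⊕ V*` given by a linear form on `V`. -/
def dualVec (d : Module.Dual ℂ V) : Vec := Sum.elim 0 fun i => d (Pi.single i 1)

theorem cliff_dualVec (d : Module.Dual ℂ V) (x : Spinor) :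
    cliff (dualVec d) x = contractLeft d x := by
  have h : dotProductBilin ℂ ℂ (fun i => d (Pi.single i 1)) = d := by
    ext i
    simp [dotProductBilin]
  rw [cliff_apply, dualVec, Sum.elim_comp_inl, Sum.elim_comp_inr, h, map_zero, zero_mul, zero_add]

theorem slToSo_mulVec_inl (A : sl5) (v : V) :
    (slToSo A).1 *ᵥ Sum.elim v 0 = Sum.elim (A.1 *ᵥ v) 0 := by
  change Matrix.fromBlocks _ _ _ _ *ᵥ _ = _
  rw [Matrix.fromBlocks_mulVec]
  simp

theorem slToSo_mulVec_dualVec (A : sl5) (d : Module.Dual ℂ V) :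
    (slToSo A).1 *ᵥ dualVec d = dualVec (dualAct A d) := by
  change Matrix.fromBlocks _ _ _ _ *ᵥ _ = _
  rw [Matrix.fromBlocks_mulVec, dualVec, dualVec]
  simp only [Sum.elim_comp_inl, Sum.elim_comp_inr, Matrix.mulVec_zero, Matrix.zero_mulVec,
    zero_add]
  congr 1
  ext i
  have : A.1 *ᵥ Pi.single i 1 = ∑ k, A.1 k i • Pi.single k (1 : ℂ) := by
    ext k; simp [Pi.single_apply]
  simp [dualAct, this, Matrix.mulVec, dotProduct]

/-- The value of an element of `so(10)` on the spinor `1`, in terms of its blocks `V* → V` and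
`V* → V*`. -/
theorem spinMat_one (M : Matrix (Fin 5 ⊕ Fin 5) (Fin 5 ⊕ Fin 5) ℂ) :
    spinMat M 1 = (1 / 2 : ℂ) • ∑ i : Fin 5, (ι ℂ (fun k => M (Sum.inl k) (Sum.inr i)) *
      ι ℂ (Pi.single i 1) + M (Sum.inr i) (Sum.inr i) • (1 : Spinor)) := by
  have h1 : ∀ i : Fin 5, (Pi.single (Sum.inl i) 1 : Vec) = Sum.elim (Pi.single i 1) 0 := by
    intro i; ext (k | k) <;> simp [Pi.single_apply]
  have h2 : ∀ i : Fin 5, cliff (Pi.single (Sum.inr i) 1) 1 = 0 := by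
    intro i
    have : (Pi.single (Sum.inr i) 1 : Vec) ∘ Sum.inl = 0 := by ext k; simp
    rw [cliff_apply, CliffordAlgebra.contractLeft_one, this, map_zero, zero_mul, zero_add]
  simp only [spinMat, LinearMap.coe_mk, AddHom.coe_mk, LinearMap.smul_apply, LinearMap.add_apply,
    LinearMap.sum_apply, Module.End.mul_apply, Fintype.sum_sum_type, Sum.swap_inl, Sum.swap_inr, h2, map_zero,
    Finset.sum_const_zero, zero_add]
  refine congrArg _ (Finset.sum_congr rfl fun i _ => ?_)
  rw [h1, cliff_inl, mul_one, cliff_apply]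
  congr 1
  · congr 2
    ext k
    simp
  · refine (CliffordAlgebra.contractLeft_ι _ _ _).trans ?_
    simp [dotProductBilin, Algebra.algebraMap_eq_smul_one]

theorem spinMat_slToSo_one (A : sl5) : spinMat (slToSo A).1 1 = 0 := by
  have hA : ∑ i, A.1 i i = 0 := A.2
  have h : ∀ i, (slToSo A).1 (Sum.inr i) (Sum.inr i) = - A.1 i i := fun i => rfl
  have h' : ∀ i, (fun k => (slToSo A).1 (Sum.inl k) (Sum.inr i)) = 0 := fun i => rfl
  rw [spinMat_one]
  simp only [h, h', map_zero, zero_mul, zero_add]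
  rw [← Finset.sum_smul, Finset.sum_neg_distrib, hA, neg_zero, zero_smul, smul_zero]

theorem spinMat_slToSo_ι_mul (A : sl5) (v : V) (x : Spinor) :
    spinMat (slToSo A).1 (ι ℂ v * x) =
      ι ℂ (A.1 *ᵥ v) * x + ι ℂ v * spinMat (slToSo A).1 x := by
  have h := LinearMap.congr_fun (spinMat_commutator (slToSo A) (Sum.elim v 0)) x
  rw [LinearMap.sub_apply, Module.End.mul_apply, Module.End.mul_apply, slToSo_mulVec_inl,
    cliff_inl, cliff_inl, cliff_inl, sub_eq_iff_eq_add] at h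
  exact h

theorem spinMat_slToSo_contract (A : sl5) (d : Module.Dual ℂ V) (x : Spinor) :
    spinMat (slToSo A).1 (contractLeft d x) =
      contractLeft (dualAct A d) x + contractLeft d (spinMat (slToSo A).1 x) := by
  have h := LinearMap.congr_fun (spinMat_commutator (slToSo A) (dualVec d)) x
  rw [LinearMap.sub_apply, Module.End.mul_apply, Module.End.mul_apply, slToSo_mulVec_dualVec,
    cliff_dualVec, cliff_dualVec, cliff_dualVec, sub_eq_iff_eq_add] at h
  exact h

/-- On spinors, `sl(5)` acts by derivations of the exterior algebra: it annihilates `1`, and the trace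
term of the spin representation vanishes. -/
theorem spinMat_slToSo_ιMulti (A : sl5) (k : ℕ) (v : Fin k → V) :
    spinMat (slToSo A).1 (ιMulti ℂ k v) =
      ∑ i, ιMulti ℂ k (Function.update v i (A.1 *ᵥ v i)) := by
  induction k with
  | zero => simp [ExteriorAlgebra.ιMulti_zero_apply, spinMat_slToSo_one]
  | succ k ih =>
    rw [ExteriorAlgebra.ιMulti_succ_apply, spinMat_slToSo_ι_mul, ih, Fin.sum_univ_succ,
      Finset.mul_sum]
    simp only [ExteriorAlgebra.ιMulti_succ_apply]
    congr 1
    refine Finset.sum_congr rfl fun i _ => ?_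
    congr 2
    ext j : 1
    by_cases h : j = i
    · subst h; simp [Matrix.vecTail]
    · simp [Matrix.vecTail, Function.update_of_ne, h]

theorem coe_wedgeAct (k : ℕ) (A : sl5) (x : ⋀[ℂ]^k V) :
    (wedgeAct k A x : Spinor) = spinMat (slToSo A).1 x := by
  suffices h : (⋀[ℂ]^k V).subtype ∘ₗ wedgeAct k A =
      spinMat (slToSo A).1 ∘ₗ (⋀[ℂ]^k V).subtype from LinearMap.congr_fun h x
  refine exteriorPower.linearMap_ext ?_
  ext v : 1
  change ((wedgeAct k A (exteriorPower.ιMulti ℂ k v) : ⋀[ℂ]^k V) : Spinor) =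
    spinMat (slToSo A).1 (ιMulti ℂ k v)
  rw [wedgeAct, extAct_ιMulti, spinMat_slToSo_ιMulti, AddSubmonoidClass.coe_finsetSum]
  rfl

/-- The volume element is invariant, because `sl(5)` is traceless. -/
theorem spinMat_slToSo_vol (A : sl5) : spinMat (slToSo A).1 vol = 0 := by
  have hA : ∑ i, A.1 i i = 0 := A.2
  have h : ∀ i, ιMulti ℂ 5 (Function.update (fun i => Pi.single i 1) i
      (A.1 *ᵥ Pi.single i 1)) = A.1 i i • vol := by
    intro i
    have : A.1 *ᵥ Pi.single i 1 = ∑ k, A.1 k i • Pi.single k (1 : ℂ) := by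
      ext k; simp [Pi.single_apply]
    rw [this, AlternatingMap.map_update_sum, Finset.sum_eq_single i]
    · rw [AlternatingMap.map_update_smul, Function.update_eq_self, vol]
    · intro k _ hk
      rw [AlternatingMap.map_update_smul,
        AlternatingMap.map_eq_zero_of_eq _ _ (i := i) (j := k) (by simp [hk]) hk.symm, smul_zero]
    · simp
  rw [vol, spinMat_slToSo_ιMulti]
  simp only [h]
  rw [← Finset.sum_smul, hA, zero_smul]

/-! ### The decomposition `S₊ = ℂ ⊕ ⋀² V ⊕ V*` -/

theorem exteriorPower_le_SPlus {k : ℕ} (hk : (k : ZMod 2) = 0) : ⋀[ℂ]^k V ≤ SPlus :=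
  le_iSup_of_le (f := fun j : {n : ℕ // (n : ZMod 2) = 0} =>
    LinearMap.range (CliffordAlgebra.ι (0 : QuadraticForm ℂ V)) ^ (j : ℕ)) ⟨k, hk⟩ le_rfl

theorem one_mem_exteriorPower_zero : (1 : Spinor) ∈ ⋀[ℂ]^0 V := by
  rw [ExteriorAlgebra.exteriorPower, pow_zero]
  exact Submodule.one_le.1 le_rfl

/-- The linear map `(c, β, ξ) ↦ c + β + ξ ⌟ vol` to spinors. The last term identifies `V*` with
`⋀⁴ V`. -/
noncomputable def spinorOf : (ℂ × ⋀[ℂ]^2 V × Module.Dual ℂ V) →ₗ[ℂ] Spinor :=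
  (LinearMap.toSpanSingleton ℂ Spinor 1).coprod
    ((⋀[ℂ]^2 V).subtype.coprod (contractLeft.flip vol))

theorem spinorOf_apply (c : ℂ) (β : ⋀[ℂ]^2 V) (ξ : Module.Dual ℂ V) :
    spinorOf (c, β, ξ) = c • 1 + (β + contractLeft ξ vol) := rfl

theorem spinorOf_mem (z) : spinorOf z ∈ SPlus := by
  obtain ⟨c, β, ξ⟩ := z
  exact add_mem (Submodule.smul_mem _ _ (exteriorPower_le_SPlus (by decide)
      one_mem_exteriorPower_zero))
    (add_mem (exteriorPower_le_SPlus (by decide) β.2)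
      (exteriorPower_le_SPlus (k := 4) (by decide) (contract_mem ξ vol_mem)))

/-- Pairing with `V` recovers the component in `V*`. -/
theorem berezin_ι_mul_spinorOf (u : V) (c : ℂ) (β : ⋀[ℂ]^2 V) (ξ : Module.Dual ℂ V) :
    berezin (ι ℂ u * spinorOf (c, β, ξ)) = ξ u := by
  have h1 : berezin (ι ℂ u * 1) = 0 :=
    berezin_pow 1 (by norm_num) _ (ι_mul_mem u one_mem_exteriorPower_zero)
  have h2 : berezin (ι ℂ u * β) = 0 := berezin_pow 3 (by norm_num) _ (ι_mul_mem u β.2)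
  rw [spinorOf_apply, mul_add, mul_add, mul_smul_comm, map_add, map_add, map_smul, h1, h2,
    ι_mul_contract_vol, map_smul, berezin_vol]
  simp

/-- The augmentation of the exterior algebra vanishes in positive degrees. -/
theorem algebraMapInv_eq_zero {k : ℕ} {x : Spinor} (hx : x ∈ ⋀[ℂ]^(k + 1) V) :
    ExteriorAlgebra.algebraMapInv x = 0 := by
  rw [← ExteriorAlgebra.ιMulti_span_fixedDegree] at hx
  induction hx using Submodule.span_induction with
  | mem x h =>
    obtain ⟨v, rfl⟩ := h
    rw [ExteriorAlgebra.ιMulti_succ_apply, map_mul, ExteriorAlgebra.algebraMapInv,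
      ExteriorAlgebra.lift_ι_apply, LinearMap.zero_apply, zero_mul]
  | zero => exact map_zero _
  | add x y _ _ hx hy => rw [map_add, hx, hy, add_zero]
  | smul c x _ hx => rw [map_smul, hx, smul_zero]

theorem spinorOf_injective : Function.Injective spinorOf := by
  rw [injective_iff_map_eq_zero]
  rintro ⟨c, β, ξ⟩ h
  -- `ξ` is recovered by the Berezin integral, then `c` by the augmentation
  have hξ : ξ = 0 := LinearMap.ext fun u => by
    rw [← berezin_ι_mul_spinorOf u c β ξ, h, mul_zero, map_zero, LinearMap.zero_apply]
  subst hξ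
  rw [spinorOf_apply, map_zero, LinearMap.zero_apply, add_zero] at h
  have hc : c = 0 := by
    have := congrArg (ExteriorAlgebra.algebraMapInv (R := ℂ) (M := V)) h
    rwa [map_add, map_smul, algebraMapInv_eq_zero β.2, map_one, add_zero, map_zero, smul_eq_mul,
      mul_one] at this
  subst hc
  rw [zero_smul, zero_add] at h
  rw [Submodule.coe_eq_zero.1 h]
  rfl

/-- Contraction with the volume element identifies `V*` with `⋀⁴ V`. -/
theorem exists_contract_vol {x : Spinor} (hx : x ∈ ⋀[ℂ]^4 V) :
    ∃ ξ : Module.Dual ℂ V, contractLeft ξ vol = x := by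
  let f : Module.Dual ℂ V →ₗ[ℂ] ⋀[ℂ]^4 V :=
    (contractLeft.flip vol).codRestrict _ fun ξ => contract_mem ξ vol_mem
  have hf : Function.Injective f := by
    intro ξ η h
    have h' : contractLeft ξ vol = contractLeft η vol := congrArg Subtype.val h
    have : spinorOf (0, 0, ξ) = spinorOf (0, 0, η) := by
      rw [spinorOf_apply, spinorOf_apply, h']
    simpa using spinorOf_injective this
  have hd : Module.finrank ℂ (Module.Dual ℂ V) = Module.finrank ℂ (⋀[ℂ]^4 V) := by
    rw [Subspace.dual_finrank_eq, exteriorPower.finrank_eq, Module.finrank_fin_fun]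
    rfl
  obtain ⟨ξ, h⟩ := (LinearMap.injective_iff_surjective_of_finrank_eq_finrank hd).1 hf ⟨x, hx⟩
  exact ⟨ξ, congrArg Subtype.val h⟩

theorem SPlus_le_range_spinorOf : SPlus ≤ LinearMap.range spinorOf := by
  refine iSup_le ?_
  rintro ⟨n, hn⟩ x hx
  change x ∈ ⋀[ℂ]^n V at hx
  by_cases h : 5 < n
  · rw [exteriorPower_eq_bot h, Submodule.mem_bot] at hx
    exact hx ▸ zero_mem _
  · push Not at h
    interval_cases n
    · rw [ExteriorAlgebra.exteriorPower, pow_zero] at hx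
      obtain ⟨c, rfl⟩ := Submodule.mem_one.1 hx
      exact ⟨(c, 0, 0), by simp [spinorOf_apply, Algebra.algebraMap_eq_smul_one]⟩
    · exact absurd hn (by decide)
    · exact ⟨(0, ⟨x, hx⟩, 0), by simp [spinorOf_apply]⟩
    · exact absurd hn (by decide)
    · obtain ⟨ξ, rfl⟩ := exists_contract_vol hx
      exact ⟨(0, 0, ξ), by simp [spinorOf_apply]⟩
    · exact absurd hn (by decide)

/-- The isomorphism `ℂ ⊕ ⋀² V ⊕ V* ≃ S₊`, `(c, β, ξ) ↦ c + β + ξ ⌟ vol`. -/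
noncomputable def spinorEquiv : (ℂ × ⋀[ℂ]^2 V × Module.Dual ℂ V) ≃ₗ[ℂ] SPlus :=
  LinearEquiv.ofBijective (spinorOf.codRestrict SPlus spinorOf_mem)
    ⟨fun _ _ h => spinorOf_injective (congrArg Subtype.val h), fun x => by
      obtain ⟨z, hz⟩ := SPlus_le_range_spinorOf x.2
      exact ⟨z, Subtype.ext hz⟩⟩

theorem coe_spinorEquiv (z) : (spinorEquiv z : Spinor) = spinorOf z := rfl

theorem spin_slToSo_spinorEquiv (A : sl5) (c : ℂ) (β : ⋀[ℂ]^2 V) (ξ : Module.Dual ℂ V) :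
    spin (slToSo A) (spinorEquiv (c, β, ξ)) = spinorEquiv (0, wedgeAct 2 A β, dualAct A ξ) := by
  refine Subtype.ext ?_
  rw [coe_spin, coe_spinorEquiv, coe_spinorEquiv, spinorOf_apply, spinorOf_apply, map_add, map_add,
    map_smul, spinMat_slToSo_one, spinMat_slToSo_contract, spinMat_slToSo_vol, coe_wedgeAct]
  simp

/-! ### Invariant spinors -/

/-- `⋀² V` has no invariants: the weights `hᵢ + hⱼ` of `h = diag (1, 1, 1, 1, -4)` on it are
nonzero. -/
theorem eq_zero_of_wedgeAct_two {β : ⋀[ℂ]^2 V} (hβ : ∀ A : sl5, wedgeAct 2 A β = 0) : β = 0 := by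
  let h : Fin 5 → ℂ := ![1, 1, 1, 1, -4]
  let H : sl5 := ⟨Matrix.diagonal h, by
    change Matrix.trace (Matrix.diagonal h) = 0
    rw [Matrix.trace_diagonal]
    simp [h, Fin.sum_univ_five]
    norm_num⟩
  have hh : ∀ i j, i ≠ j → h i + h j ≠ 0 := by
    intro i j hij
    fin_cases i <;> fin_cases j <;> first | exact absurd rfl hij | (simp [h]; try norm_num)
  let b := (Pi.basisFun ℂ (Fin 5)).exteriorPower 2
  let idx (s : Set.powersetCard (Fin 5) 2) : Fin 2 → Fin 5 := Set.powersetCard.ofFinEmbEquiv.symm s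
  have hb : ∀ s, wedgeAct 2 H (b s) = (∑ i, h (idx s i)) • b s := by
    intro s
    rw [exteriorPower.basis_apply, exteriorPower.ιMulti_family, wedgeAct, extAct_ιMulti,
      Finset.sum_smul]
    refine Finset.sum_congr rfl fun i _ => ?_
    have : H.1.mulVecLin (Pi.basisFun ℂ (Fin 5) (idx s i)) =
        h (idx s i) • Pi.basisFun ℂ (Fin 5) (idx s i) := by
      ext k
      simp [H, Pi.single_apply]
    rw [Function.comp_apply]
    erw [this]
    rw [AlternatingMap.map_update_smul]
    erw [Function.update_eq_self]
  have hc : ∀ s, b.coord s ∘ₗ wedgeAct 2 H = (∑ i, h (idx s i)) • b.coord s := by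
    intro s
    refine b.ext fun t => ?_
    rw [LinearMap.comp_apply, hb, map_smul, LinearMap.smul_apply, Module.Basis.coord_apply,
      Module.Basis.repr_self]
    by_cases hst : t = s
    · rw [hst]
    · simp [Finsupp.single_eq_of_ne' hst]
  refine b.forall_coord_eq_zero_iff.1 fun s => ?_
  have := LinearMap.congr_fun (hc s) β
  rw [LinearMap.comp_apply, hβ, map_zero, LinearMap.smul_apply, smul_eq_mul, Fin.sum_univ_two] at this
  refine (mul_eq_zero.1 this.symm).resolve_left (hh _ _ ?_)
  exact fun h => absurd ((Set.powersetCard.ofFinEmbEquiv.symm s).injective h) (by decide)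

/-- `V*` has no invariants: for `j ≠ i` the elementary matrix `Eᵢⱼ` moves the `i`-th coefficient of
a linear form to the `j`-th, up to sign. -/
theorem eq_zero_of_dualAct {ξ : Module.Dual ℂ V} (hξ : ∀ A : sl5, dualAct A ξ = 0) : ξ = 0 := by
  ext i
  obtain ⟨j, hj⟩ := exists_ne i
  have h := LinearMap.congr_fun (hξ ⟨Matrix.single i j 1, by
    change Matrix.trace (Matrix.single i j 1) = 0
    exact Matrix.trace_single_eq_of_ne _ _ _ hj.symm⟩) (Pi.single j 1)
  have e : (Matrix.single i j 1 : Matrix (Fin 5) (Fin 5) ℂ) *ᵥ Pi.single j 1 = Pi.single i 1 := by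
    ext k
    simp [Matrix.single_apply, Pi.single_apply, eq_comm]
  simp [dualAct, e] at h
  simpa using h

/-- The invariant spinors in `S₊` are the constants. -/
theorem exists_eq_smul_one_of_invariant {ψ : SPlus} (hψ : ∀ A : sl5, spin (slToSo A) ψ = 0) :
    ∃ c : ℂ, (ψ : Spinor) = c • 1 := by
  obtain ⟨⟨c, β, ξ⟩, rfl⟩ := spinorEquiv.surjective ψ
  have h : ∀ A : sl5, wedgeAct 2 A β = 0 ∧ dualAct A ξ = 0 := by
    intro A
    have := hψ A
    rw [spin_slToSo_spinorEquiv, LinearEquiv.map_eq_zero_iff] at this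
    simpa using this
  rw [coe_spinorEquiv, spinorOf_apply, eq_zero_of_wedgeAct_two fun A => (h A).1,
    eq_zero_of_dualAct fun A => (h A).2]
  exact ⟨c, by simp⟩

/-! ### The vectors `Γ⁺(1, s)` -/

theorem spinForm_one (x : Spinor) : spinForm 1 x = berezin x := by
  rw [spinForm_apply, CliffordAlgebra.reverse.map_one, one_mul]

/-- `Γ(1, -)` projects `S₊` onto its summand `V*`. -/
theorem gammaMap_one_spinorOf (c : ℂ) (β : ⋀[ℂ]^2 V) (ξ : Module.Dual ℂ V) :
    gammaMap 1 (spinorOf (c, β, ξ)) = dualVec ξ := by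
  ext (i | i)
  · have h : (Pi.single (Sum.inr i) 1 : Vec) = dualVec (LinearMap.proj i) := by
      ext (k | k) <;> simp [dualVec, Pi.single_apply, eq_comm]
    change spinForm 1 (cliff (Pi.single (Sum.inr i) 1) _) = 0
    rw [spinForm_one, h, cliff_dualVec, berezin_contract]
  · have h : (Pi.single (Sum.inl i) 1 : Vec) = Sum.elim (Pi.single i 1) 0 := by
      ext (k | k) <;> simp [Pi.single_apply]
    change spinForm 1 (cliff (Pi.single (Sum.inl i) 1) _) = ξ (Pi.single i 1)
    rw [spinForm_one, h, cliff_inl, berezin_ι_mul_spinorOf]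

/-! ### Elements of `so(10)` in blocks -/

/-- Skewness with respect to `pair`, entrywise. -/
theorem so10_apply (X : so10) (a b : Fin 5 ⊕ Fin 5) : X.1 a.swap b = - X.1 b.swap a := by
  have h := pair_skew X (Pi.single b 1) (Pi.single a 1)
  rw [pair_comm, pair_single_left, pair_single_left] at h
  simpa using h

theorem fromBlocks_mem_so10 (A : Matrix (Fin 5) (Fin 5) ℂ) {B C : Matrix (Fin 5) (Fin 5) ℂ}
    (hB : Bᵀ = -B) (hC : Cᵀ = -C) : Matrix.fromBlocks A B C (-Aᵀ) ∈ so10 := by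
  refine (mem_skewAdjointMatricesLieSubalgebra _ _).2 ((mem_skewAdjointMatricesSubmodule _ _).2 ?_)
  change (Matrix.fromBlocks A B C (-Aᵀ))ᵀ * Matrix.fromBlocks 0 1 1 0 =
    Matrix.fromBlocks 0 1 1 0 * -Matrix.fromBlocks A B C (-Aᵀ)
  simp [Matrix.fromBlocks_transpose, Matrix.fromBlocks_neg, Matrix.fromBlocks_multiply, hB, hC]

/-- An element of `so(10)` fixes the spinor `1` if and only if its block `V* → V` vanishes and its
block `V → V` is traceless. -/
theorem spinMat_one_eq_zero_iff (X : so10) :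
    spinMat X.1 1 = 0 ↔
      (∀ i j, X.1 (Sum.inl i) (Sum.inr j) = 0) ∧ ∑ i, X.1 (Sum.inl i) (Sum.inl i) = 0 := by
  have hD : ∑ i, X.1 (Sum.inr i) (Sum.inr i) = - ∑ i, X.1 (Sum.inl i) (Sum.inl i) := by
    rw [← Finset.sum_neg_distrib]
    exact Finset.sum_congr rfl fun i _ => so10_apply X (Sum.inl i) (Sum.inr i)
  have key : (∀ i j, X.1 (Sum.inl i) (Sum.inr j) = 0) →
      spinMat X.1 1 = (1 / 2 : ℂ) • (- ∑ i, X.1 (Sum.inl i) (Sum.inl i)) • (1 : Spinor) := by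
    intro h
    have h' : ∀ i, (fun k => X.1 (Sum.inl k) (Sum.inr i)) = 0 := fun i => funext fun k => h k i
    rw [spinMat_one]
    simp only [h', map_zero, zero_mul, zero_add]
    rw [← Finset.sum_smul, hD]
  refine ⟨fun h => ?_, fun h => by rw [key h.1, h.2]; simp⟩
  -- `V*` annihilates the spinor `1`, hence so does its image under `X`
  have hB : ∀ i j, X.1 (Sum.inl i) (Sum.inr j) = 0 := by
    intro i j
    have hc := LinearMap.congr_fun (spinMat_commutator X (dualVec (LinearMap.proj j))) 1
    rw [LinearMap.sub_apply, Module.End.mul_apply, Module.End.mul_apply, h, map_zero,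
      cliff_dualVec, CliffordAlgebra.contractLeft_one, map_zero, sub_zero, cliff_apply,
      CliffordAlgebra.contractLeft_one, add_zero, mul_one] at hc
    have hv := (ExteriorAlgebra.ι_eq_zero_iff (R := ℂ) _).1 hc.symm
    have hj : dualVec (LinearMap.proj j) = Pi.single (Sum.inr j) 1 := by
      ext (k | k) <;> simp [dualVec, Pi.single_apply, eq_comm]
    have := congrFun hv i
    rw [hj] at this
    simpa using this
  refine ⟨hB, ?_⟩
  rw [key hB] at h
  simpa using h

/-- The tangent space to the orbit of the spinor `1` is `ℂ ⊕ ⋀² V`. -/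
theorem exists_spinMat_one_eq (c : ℂ) (β : ⋀[ℂ]^2 V) :
    ∃ X : so10, spinMat X.1 1 = c • 1 + (β : Spinor) := by
  let f : so10 →ₗ[ℂ] Spinor := LinearMap.applyₗ 1 ∘ₗ spinMat ∘ₗ so10.toSubmodule.subtype
  have hf : ∀ X, f X = spinMat X.1 1 := fun _ => rfl
  suffices h : c • 1 + (β : Spinor) ∈ LinearMap.range f from h
  refine add_mem (Submodule.smul_mem _ _ ?_) ?_
  -- `A` acts on `1` by `-½ tr A`, and `-2/5` times the identity has trace `-2`
  · refine ⟨⟨_, fromBlocks_mem_so10 (Matrix.diagonal fun _ => -(2 / 5 : ℂ)) (B := 0) (C := 0)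
      (by simp) (by simp)⟩, ?_⟩
    rw [hf, spinMat_one]
    have h' : ∀ i : Fin 5, (fun k => Matrix.fromBlocks (Matrix.diagonal fun _ => -(2 / 5 : ℂ))
      (0 : Matrix (Fin 5) (Fin 5) ℂ) (0 : Matrix (Fin 5) (Fin 5) ℂ)
      (-(Matrix.diagonal fun _ => -(2 / 5 : ℂ))ᵀ) (Sum.inl k) (Sum.inr i)) = 0 := fun i => rfl
    simp only [h', map_zero, zero_mul, zero_add]
    rw [← Finset.sum_smul, smul_smul]
    norm_num
  · obtain ⟨β, hβ⟩ := β
    change β ∈ _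
    rw [← ExteriorAlgebra.ιMulti_span_fixedDegree] at hβ
    refine Submodule.span_le.2 ?_ hβ
    rintro _ ⟨w, rfl⟩
    set u := w 0
    set v := w 1
    -- the skew map `ξ ↦ ξ(v) u - ξ(u) v` sends `1` to `½ (u ∧ v - v ∧ u) = u ∧ v`
    refine ⟨⟨_, fromBlocks_mem_so10 0 (B := Matrix.of fun k i => v i * u k - u i * v k) (C := 0)
      (by ext i k; simp; ring) (by simp)⟩, ?_⟩
    have h1 : ∀ i : Fin 5, (fun k => Matrix.fromBlocks (0 : Matrix (Fin 5) (Fin 5) ℂ)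
        (Matrix.of fun k i => v i * u k - u i * v k) (0 : Matrix (Fin 5) (Fin 5) ℂ)
        (-(0 : Matrix (Fin 5) (Fin 5) ℂ)ᵀ) (Sum.inl k) (Sum.inr i)) = v i • u - u i • v :=
      fun i => rfl
    have h2 : ∀ i : Fin 5, Matrix.fromBlocks (0 : Matrix (Fin 5) (Fin 5) ℂ)
        (Matrix.of fun k i => v i * u k - u i * v k) (0 : Matrix (Fin 5) (Fin 5) ℂ)
        (-(0 : Matrix (Fin 5) (Fin 5) ℂ)ᵀ) (Sum.inr i) (Sum.inr i) = 0 := fun i => by simp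
    have h3 : ∀ x : V, ι ℂ x = ∑ i, x i • ι ℂ (Pi.single i 1) := by
      intro x
      conv_lhs => rw [pi_eq_sum_univ' x]
      simp only [map_sum, map_smul]
    have h4 : ι ℂ v * ι ℂ u = - (ι ℂ u * ι ℂ v) :=
      eq_neg_of_add_eq_zero_left (ExteriorAlgebra.ι_add_mul_swap v u)
    have h5 : ∑ i, ι ℂ (v i • u - u i • v) * ι ℂ (Pi.single i 1) =
        ι ℂ u * ι ℂ v - ι ℂ v * ι ℂ u := by
      have e1 : ι ℂ u * ι ℂ v = ∑ i, v i • (ι ℂ u * ι ℂ (Pi.single i 1)) := by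
        simp only [h3 v, Finset.mul_sum, mul_smul_comm]
      have e2 : ι ℂ v * ι ℂ u = ∑ i, u i • (ι ℂ v * ι ℂ (Pi.single i 1)) := by
        simp only [h3 u, Finset.mul_sum, mul_smul_comm]
      rw [e1, e2, ← Finset.sum_sub_distrib]
      refine Finset.sum_congr rfl fun i _ => ?_
      rw [map_sub, map_smul, map_smul, sub_mul, smul_mul_assoc, smul_mul_assoc]
    have h6 : ιMulti ℂ 2 w = ι ℂ u * ι ℂ v := by
      rw [ExteriorAlgebra.ιMulti_succ_apply, ExteriorAlgebra.ιMulti_succ_apply,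
        ExteriorAlgebra.ιMulti_zero_apply, mul_one]
      rfl
    rw [hf, spinMat_one]
    simp only [h1, h2, zero_smul, add_zero]
    rw [h5, h4, h6, sub_neg_eq_add, ← two_smul ℂ, smul_smul]
    norm_num

/-! ### The stabilizer `sl(5) ⊕ ⋀³ V` of the spinor `1` -/

/-- The skew form `(u, v) ↦ ∫ u ∧ v ∧ τ` on `V` given by `τ ∈ ⋀³ V`, as a matrix. -/
noncomputable def skewMatrix : ⋀[ℂ]^3 V →ₗ[ℂ] Matrix (Fin 5) (Fin 5) ℂ where
  toFun τ := Matrix.of fun i k => berezin (ι ℂ (Pi.single i 1 : V) * (ι ℂ (Pi.single k 1 : V) * (τ : Spinor)))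
  map_add' τ ω := by ext i k; simp [mul_add]
  map_smul' c τ := by ext i k; simp

theorem skewMatrix_apply (τ : ⋀[ℂ]^3 V) (i k : Fin 5) :
    skewMatrix τ i k = berezin (ι ℂ (Pi.single i 1 : V) * (ι ℂ (Pi.single k 1 : V) * (τ : Spinor))) := rfl

theorem skewMatrix_transpose (τ : ⋀[ℂ]^3 V) : (skewMatrix τ)ᵀ = - skewMatrix τ := by
  ext i k
  have h := ExteriorAlgebra.ι_add_mul_swap (R := ℂ) (Pi.single k 1 : V) (Pi.single i 1)
  rw [Matrix.transpose_apply, Matrix.neg_apply, skewMatrix_apply, skewMatrix_apply, ← mul_assoc,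
    ← mul_assoc, eq_neg_of_add_eq_zero_left h, neg_mul, map_neg]

/-- Double contractions of the volume element are dual to wedge products of two vectors. -/
theorem berezin_contract_contract_vol (u v : V) (d d' : Module.Dual ℂ V) :
    berezin (ι ℂ u * (ι ℂ v * contractLeft d (contractLeft d' vol))) = d v * d' u - d u * d' v := by
  have h := contract_ι_mul d v (contractLeft d' vol)
  rw [ι_mul_contract_vol, map_smul, eq_sub_iff_add_eq, ← eq_sub_iff_add_eq'] at h
  rw [h, mul_sub, mul_smul_comm, mul_smul_comm, ι_mul_contract_vol, ι_mul_contract_vol, map_sub,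
    map_smul, map_smul, map_smul, map_smul, berezin_vol]
  simp [mul_comm]

/-- Upper triangular entries identify `⋀³ V` with the skew forms on `V`: they are dual to the
contractions of the volume element with pairs of coordinates, and the dimensions agree. -/
theorem skewMatrix_upper_bijective :
    Function.Bijective fun (τ : ⋀[ℂ]^3 V) (p : {p : Fin 5 × Fin 5 // p.1 < p.2}) =>
      skewMatrix τ p.1.1 p.1.2 := by
  let L : ⋀[ℂ]^3 V →ₗ[ℂ] ({p : Fin 5 × Fin 5 // p.1 < p.2} → ℂ) :=
    LinearMap.pi fun p => Matrix.entryLinearMap ℂ ℂ p.1.1 p.1.2 ∘ₗ skewMatrix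
  have hs : Function.Surjective L := by
    intro f
    let T (p : {p : Fin 5 × Fin 5 // p.1 < p.2}) : ⋀[ℂ]^3 V :=
      ⟨contractLeft (LinearMap.proj p.1.2) (contractLeft (LinearMap.proj p.1.1) vol),
        contract_mem _ (contract_mem _ vol_mem)⟩
    have hT : ∀ p, L (T p) = Pi.single p 1 := by
      rintro ⟨⟨i, j⟩, hij⟩
      ext ⟨⟨k, l⟩, hkl⟩
      change berezin (_ * (_ * contractLeft _ (contractLeft _ vol))) = _
      rw [berezin_contract_contract_vol]
      simp only [LinearMap.proj_apply, Pi.single_apply, Subtype.mk.injEq, Prod.mk.injEq]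
      have h0 : ¬ (j = k ∧ i = l) := by
        rintro ⟨rfl, rfl⟩
        exact lt_asymm hij hkl
      by_cases h1 : j = l <;> by_cases h2 : i = k <;> by_cases h3 : j = k <;>
        by_cases h4 : i = l <;> simp_all [eq_comm]
    refine ⟨∑ p, f p • T p, ?_⟩
    simp only [map_sum, map_smul, hT]
    exact (pi_eq_sum_univ' f).symm
  have hd : Module.finrank ℂ (⋀[ℂ]^3 V) =
      Module.finrank ℂ ({p : Fin 5 × Fin 5 // p.1 < p.2} → ℂ) := by
    rw [exteriorPower.finrank_eq, Module.finrank_fin_fun, Module.finrank_fintype_fun_eq_card]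
    decide
  exact ⟨(LinearMap.injective_iff_surjective_of_finrank_eq_finrank hd).2 hs, hs⟩

theorem skewMatrix_injective : Function.Injective skewMatrix := fun τ ω h =>
  skewMatrix_upper_bijective.1 (by simp only [h])

theorem exists_skewMatrix_eq {C : Matrix (Fin 5) (Fin 5) ℂ} (hC : ∀ i k, C i k = - C k i) :
    ∃ τ, skewMatrix τ = C := by
  obtain ⟨τ, hτ⟩ := skewMatrix_upper_bijective.2 fun p => C p.1.1 p.1.2
  have hlt : ∀ i k, i < k → skewMatrix τ i k = C i k := fun i k h => congrFun hτ ⟨(i, k), h⟩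
  have hsk : ∀ i k, skewMatrix τ i k = - skewMatrix τ k i := fun i k =>
    congrFun (congrFun (skewMatrix_transpose τ) k) i
  refine ⟨τ, ?_⟩
  ext i k
  rcases lt_trichotomy i k with h | rfl | h
  · exact hlt i k h
  · rw [self_eq_neg.1 (hsk i i), self_eq_neg.1 (hC i i)]
  · rw [hsk, hC, hlt k i h]

/-- The Berezin integral is invariant: it is the spin-invariant pairing with the invariant spinor
`1`. -/
theorem berezin_spinMat_slToSo (A : sl5) (x : Spinor) :
    berezin (spinMat (slToSo A).1 x) = 0 := by
  have h := spinForm_spinMat (slToSo A) 1 x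
  rw [spinMat_slToSo_one, map_zero, LinearMap.zero_apply, spinForm_one] at h
  exact neg_eq_zero.1 h.symm

/-- Equivariance of `skewMatrix`, by the invariance of the Berezin integral. -/
theorem skewMatrix_wedgeAct (A : sl5) (τ : ⋀[ℂ]^3 V) :
    skewMatrix (wedgeAct 3 A τ) = - (A.1ᵀ * skewMatrix τ) - skewMatrix τ * A.1 := by
  ext i k
  have h := berezin_spinMat_slToSo A (ι ℂ (Pi.single i 1 : V) * (ι ℂ (Pi.single k 1 : V) * (τ : Spinor)))
  have e : ∀ i, ι ℂ (A.1 *ᵥ Pi.single i 1) = ∑ m, A.1 m i • ι ℂ (Pi.single m 1) := by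
    intro i
    conv_lhs => rw [pi_eq_sum_univ' (A.1 *ᵥ Pi.single i 1)]
    simp
  rw [spinMat_slToSo_ι_mul, spinMat_slToSo_ι_mul, ← coe_wedgeAct, mul_add, map_add, map_add,
    ← skewMatrix_apply, e, e, Finset.sum_mul, Finset.sum_mul, Finset.mul_sum, map_sum,
    map_sum] at h
  simp only [smul_mul_assoc, mul_smul_comm, map_smul, smul_eq_mul, ← skewMatrix_apply] at h
  rw [Matrix.sub_apply, Matrix.neg_apply, Matrix.mul_apply, Matrix.mul_apply]
  simp only [Matrix.transpose_apply, mul_comm (skewMatrix τ i _)]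
  linear_combination h

/-- The inclusion `⋀³ V ⊂ so(10)`: `τ` maps `V` to `V*` by `v ↦ ∫ (-) ∧ v ∧ τ` and annihilates
`V*`. -/
noncomputable def wedgeToSo : ⋀[ℂ]^3 V →ₗ[ℂ] so10 where
  toFun τ := ⟨Matrix.fromBlocks 0 0 (skewMatrix τ) 0, by
    simpa using fromBlocks_mem_so10 0 (B := 0) (by simp) (skewMatrix_transpose τ)⟩
  map_add' τ ω := by
    refine Subtype.ext ?_
    change _ = Matrix.fromBlocks _ _ _ _ + Matrix.fromBlocks _ _ _ _
    simp [Matrix.fromBlocks_add]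
  map_smul' c τ := by
    refine Subtype.ext ?_
    change _ = c • Matrix.fromBlocks _ _ _ _
    simp [Matrix.fromBlocks_smul]

/-- The inclusion `sl(5) ⊕ ⋀³ V ⊂ so(10)`. -/
noncomputable def stabToSo : (sl5 × ⋀[ℂ]^3 V) →ₗ[ℂ] so10 := slToSo.coprod wedgeToSo

theorem coe_stabToSo (A : sl5) (τ : ⋀[ℂ]^3 V) :
    (stabToSo (A, τ)).1 = Matrix.fromBlocks A.1 0 (skewMatrix τ) (-A.1ᵀ) := by
  change Matrix.fromBlocks _ _ _ _ + Matrix.fromBlocks _ _ _ _ = _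
  simp [Matrix.fromBlocks_add]

theorem stabToSo_sl (A : sl5) : stabToSo (A, 0) = slToSo A := by simp [stabToSo]

theorem stabToSo_injective : Function.Injective stabToSo := by
  rintro ⟨A, τ⟩ ⟨B, ω⟩ h
  have h' := congrArg Subtype.val h
  rw [coe_stabToSo, coe_stabToSo, Matrix.fromBlocks_inj] at h'
  exact Prod.ext (Subtype.ext h'.1) (skewMatrix_injective h'.2.2.1)

theorem mem_range_stabToSo_iff (X : so10) :
    X ∈ LinearMap.range stabToSo ↔ spinMat X.1 1 = 0 := by
  rw [spinMat_one_eq_zero_iff]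
  constructor
  · rintro ⟨⟨A, τ⟩, rfl⟩
    rw [coe_stabToSo]
    exact ⟨fun i j => rfl, A.2⟩
  · rintro ⟨hB, hA⟩
    obtain ⟨τ, hτ⟩ := exists_skewMatrix_eq (C := X.1.toBlocks₂₁) fun i k =>
      so10_apply X (Sum.inl i) (Sum.inl k)
    refine ⟨(⟨X.1.toBlocks₁₁, hA⟩, τ), Subtype.ext ?_⟩
    rw [coe_stabToSo, hτ]
    conv_rhs => rw [← Matrix.fromBlocks_toBlocks X.1]
    congr 1
    · ext i j
      exact (hB i j).symm
    · ext i j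
      exact (so10_apply X (Sum.inl i) (Sum.inr j)).symm

theorem stabToSo_lie (A B : sl5) (τ ω : ⋀[ℂ]^3 V) :
    ⁅stabToSo (A, τ), stabToSo (B, ω)⁆ =
      stabToSo (⁅A, B⁆, wedgeAct 3 A ω - wedgeAct 3 B τ) := by
  refine Subtype.ext ?_
  rw [LieSubalgebra.coe_bracket, Ring.lie_def, coe_stabToSo, coe_stabToSo, coe_stabToSo, map_sub,
    skewMatrix_wedgeAct, skewMatrix_wedgeAct, LieSubalgebra.coe_bracket, Ring.lie_def,
    Matrix.fromBlocks_multiply, Matrix.fromBlocks_multiply, sub_eq_add_neg, Matrix.fromBlocks_neg,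
    Matrix.fromBlocks_add]
  congr 1
  · simp [sub_eq_add_neg]
  · simp
  · simp only [Matrix.neg_mul]; abel
  · simp only [Matrix.transpose_sub, Matrix.transpose_mul, Matrix.neg_mul, Matrix.mul_neg, neg_neg,
      Matrix.mul_zero, zero_add]; abel

theorem stabToSo_mulVec (A : sl5) (τ : ⋀[ℂ]^3 V) (v : V) :
    (stabToSo (A, τ)).1 *ᵥ Sum.elim v 0 = Sum.elim (A.1 *ᵥ v) (skewMatrix τ *ᵥ v) := by
  rw [coe_stabToSo, Matrix.fromBlocks_mulVec]
  simp

/-! ### Brackets in the supersymmetry algebra -/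

theorem siso_b00 (x y : so10 × Vec) :
    siso.b00 x y = (⁅x.1, y.1⁆, x.1.1 *ᵥ y.2 - y.1.1 *ᵥ x.2) := rfl

theorem siso_b01_tmul (x : so10 × Vec) (s : SPlus) (a : C2) :
    siso.b01 x (s ⊗ₜ a) = spin x.1 s ⊗ₜ a := rfl

theorem siso_b11_tmul (s t : SPlus) (a b : C2) :
    siso.b11 (s ⊗ₜ a) (t ⊗ₜ b) = (0, (a ⬝ᵥ b) • gammaPlus s t) :=
  congrArg (Prod.mk 0) (superTranslation_tmul s t a b)

/-- The component in `S₊ ⊗ eᵢ ≅ S₊` of an element of `S₊ ⊗ ℂ²`. -/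
noncomputable def component (i : Fin 2) : SPlus ⊗[ℂ] C2 →ₗ[ℂ] SPlus :=
  (TensorProduct.rid ℂ SPlus).toLinearMap ∘ₗ (LinearMap.proj i).lTensor SPlus

theorem component_tmul (i : Fin 2) (s : SPlus) (a : C2) : component i (s ⊗ₜ a) = a i • s := by
  simp [component]

theorem eq_component_add (x : SPlus ⊗[ℂ] C2) :
    x = component 0 x ⊗ₜ e 0 + component 1 x ⊗ₜ e 1 := by
  induction x with
  | zero => simp
  | add x y hx hy =>
    rw [map_add, map_add, TensorProduct.add_tmul, TensorProduct.add_tmul]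
    conv_lhs => rw [hx, hy]
    abel
  | tmul s a =>
    have ha : a = a 0 • e 0 + a 1 • e 1 := by ext i; fin_cases i <;> simp
    rw [component_tmul, component_tmul]
    conv_lhs => rw [ha]
    rw [TensorProduct.tmul_add, TensorProduct.tmul_smul, TensorProduct.tmul_smul,
      TensorProduct.smul_tmul', TensorProduct.smul_tmul']

theorem tmul_e_injective (i : Fin 2) : Function.Injective fun s : SPlus => s ⊗ₜ[ℂ] e i := by
  intro s t h
  simpa [component_tmul] using congrArg (component i) h

theorem siso_b11_tmul_e_zero (s : SPlus) (x : SPlus ⊗[ℂ] C2) :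
    siso.b11 (s ⊗ₜ e 0) x = (0, gammaPlus s (component 0 x)) := by
  conv_lhs => rw [eq_component_add x]
  rw [map_add, siso_b11_tmul, siso_b11_tmul]
  simp

/-! ### Cocycles and coboundaries of a nonzero constant spinor -/

section Constant

variable {ψ : SPlus} {c : ℂ}

theorem spin_eq_zero_iff (hc : c ≠ 0) (hψ : (ψ : Spinor) = c • 1) (X : so10) :
    spin X ψ = 0 ↔ spinMat X.1 1 = 0 := by
  rw [← Submodule.coe_eq_zero, coe_spin, hψ, map_smul, smul_eq_zero_iff_right hc]

theorem gammaPlus_spinorEquiv (hψ : (ψ : Spinor) = c • 1) (a : ℂ) (β : ⋀[ℂ]^2 V)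
    (ξ : Module.Dual ℂ V) : gammaPlus ψ (spinorEquiv (a, β, ξ)) = c • dualVec ξ := by
  change gammaMap (ψ : Spinor) (spinorOf _) = _
  rw [hψ, map_smul, LinearMap.smul_apply, gammaMap_one_spinorOf]

/-- `Γ⁺(ψ, -)` takes values in `V*`. -/
theorem gammaPlus_inl (hψ : (ψ : Spinor) = c • 1) (s : SPlus) (i : Fin 5) :
    gammaPlus ψ s (Sum.inl i) = 0 := by
  obtain ⟨⟨a, β, ξ⟩, rfl⟩ := spinorEquiv.surjective s
  rw [gammaPlus_spinorEquiv hψ]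
  simp [dualVec]

/-- Translations in `V*` are exact. -/
theorem exists_b11_eq (hc : c ≠ 0) (hψ : (ψ : Spinor) = c • 1) (w : V) :
    ∃ a, siso.b11 (ψ ⊗ₜ e 0) a = (0, Sum.elim (0 : V) w) := by
  refine ⟨spinorEquiv (0, 0, c⁻¹ • dotProductBilin ℂ ℂ w) ⊗ₜ e 0, ?_⟩
  rw [siso_b11_tmul, gammaPlus_spinorEquiv hψ]
  refine congrArg (Prod.mk 0) ?_
  ext (i | i) <;> simp [dualVec, dotProductBilin, hc]

/-- The even cocycles are the elements of the stabilizer together with all translations. -/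
theorem mem_Z₀_iff (hc : c ≠ 0) (hψ : (ψ : Spinor) = c • 1) (x : so10 × Vec) :
    x ∈ siso.Z₀ (ψ ⊗ₜ e 0) ↔ x.1 ∈ LinearMap.range stabToSo := by
  rw [LieSuperalgebra.mem_Z₀, siso_b01_tmul, mem_range_stabToSo_iff, ← spin_eq_zero_iff hc hψ]
  exact ⟨fun h => tmul_e_injective 0 (h.trans (TensorProduct.zero_tmul _ _).symm),
    fun h => by rw [h, TensorProduct.zero_tmul]⟩

theorem tmul_e_one_mem_Z₁ (s : SPlus) : s ⊗ₜ e 1 ∈ siso.Z₁ (ψ ⊗ₜ e 0) := by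
  rw [LieSuperalgebra.mem_Z₁, siso_b11_tmul_e_zero, component_tmul]
  simp

/-- A spinor `s` with `Γ⁺(ψ, s) = 0` is tangent to the orbit of `ψ`. -/
theorem exists_spin_eq (hc : c ≠ 0) (hψ : (ψ : Spinor) = c • 1) {s : SPlus}
    (hs : gammaPlus ψ s = 0) : ∃ X, spin X ψ = s := by
  obtain ⟨⟨a, β, ξ⟩, rfl⟩ := spinorEquiv.surjective s
  have hξ : ξ = 0 := by
    rw [gammaPlus_spinorEquiv hψ, smul_eq_zero_iff_right hc] at hs
    ext i
    simpa [dualVec] using congrFun hs (Sum.inr i)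
  obtain ⟨X, hX⟩ := exists_spinMat_one_eq a β
  refine ⟨c⁻¹ • X, Subtype.ext ?_⟩
  rw [map_smul, LinearMap.smul_apply, Submodule.coe_smul, coe_spin, hψ, map_smul,
    inv_smul_smul₀ hc, hX, coe_spinorEquiv, spinorOf_apply, hξ]
  simp

/-! ### The cohomology -/

/-- The even representatives: elements of the stabilizer and translations in `V`. -/
noncomputable def evenRep : ((sl5 × ⋀[ℂ]^3 V) × V) →ₗ[ℂ] so10 × Vec where
  toFun x := (stabToSo x.1, Sum.elim x.2 0)
  map_add' x y := by
    ext1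
    · simp
    · ext (i | i) <;> simp
  map_smul' a x := by
    ext1
    · simp
    · ext (i | i) <;> simp

theorem evenRep_apply (p : sl5 × ⋀[ℂ]^3 V) (v : V) :
    evenRep (p, v) = (stabToSo p, Sum.elim v 0) := rfl

theorem evenRep_mem_Z₀ (hc : c ≠ 0) (hψ : (ψ : Spinor) = c • 1) (x) :
    evenRep x ∈ siso.Z₀ (ψ ⊗ₜ e 0) :=
  (mem_Z₀_iff hc hψ _).2 ⟨x.1, rfl⟩

/-- Elements of `so(10) ⊕ ℂ¹⁰` with the same rotation and the same translation in `V` differ by a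
coboundary. -/
theorem exists_b11_eq_sub (hc : c ≠ 0) (hψ : (ψ : Spinor) = c • 1) {x y : so10 × Vec}
    (h : x.1 = y.1) (h' : ∀ i, x.2 (Sum.inl i) = y.2 (Sum.inl i)) :
    ∃ a, siso.b11 (ψ ⊗ₜ e 0) a = x - y := by
  obtain ⟨a, ha⟩ := exists_b11_eq hc hψ fun i => x.2 (Sum.inr i) - y.2 (Sum.inr i)
  refine ⟨a, ha.trans (Prod.ext (sub_eq_zero.2 h).symm ?_)⟩
  ext (i | i)
  · exact (sub_eq_zero.2 (h' i)).symm
  · rfl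

/-- No nonzero element of `sl(5) ⊕ ⋀³ V ⊕ V` is a coboundary, since coboundaries are translations in
`V*`. -/
theorem eq_zero_of_b11_eq_evenRep (hψ : (ψ : Spinor) = c • 1) (x : (sl5 × ⋀[ℂ]^3 V) × V)
    (a : SPlus ⊗[ℂ] C2) (h : siso.b11 (ψ ⊗ₜ e 0) a = evenRep x) : x = 0 := by
  rw [siso_b11_tmul_e_zero] at h
  have h1 : (0 : so10) = stabToSo x.1 := congrArg Prod.fst h
  refine Prod.ext (stabToSo_injective (h1.symm.trans (map_zero _).symm)) (funext fun i => ?_)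
  have h2 := congrFun (congrArg Prod.snd h) (Sum.inl i)
  exact h2.symm.trans (gammaPlus_inl hψ _ i)

theorem exists_evenRep_sub (hc : c ≠ 0) (hψ : (ψ : Spinor) = c • 1) (x : so10 × Vec)
    (hx : x ∈ siso.Z₀ (ψ ⊗ₜ e 0)) : ∃ m a, siso.b11 (ψ ⊗ₜ e 0) a = evenRep m - x := by
  obtain ⟨p, hp⟩ := (mem_Z₀_iff hc hψ _).1 hx
  exact ⟨(p, fun i => x.2 (Sum.inl i)), exists_b11_eq_sub hc hψ hp fun i => rfl⟩

/-- The even part of the cohomology. -/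
noncomputable def evenEquiv (hc : c ≠ 0) (hψ : (ψ : Spinor) = c • 1) :
    ((sl5 × ⋀[ℂ]^3 V) × V) ≃ₗ[ℂ] siso.H₀ (ψ ⊗ₜ e 0) :=
  siso.equivH₀ (ψ ⊗ₜ e 0) evenRep (evenRep_mem_Z₀ hc hψ) (eq_zero_of_b11_eq_evenRep hψ)
    (exists_evenRep_sub hc hψ)

theorem evenEquiv_apply (hc : c ≠ 0) (hψ : (ψ : Spinor) = c • 1) (p : sl5 × ⋀[ℂ]^3 V) (v : V) :
    evenEquiv hc hψ (p, v) = siso.mk₀ (ψ ⊗ₜ e 0) (stabToSo p, Sum.elim v 0)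
      (evenRep_mem_Z₀ hc hψ (p, v)) :=
  siso.equivH₀_apply (ψ ⊗ₜ e 0) evenRep (evenRep_mem_Z₀ hc hψ) (eq_zero_of_b11_eq_evenRep hψ)
    (exists_evenRep_sub hc hψ) (p, v)

/-- The odd representatives: the supersymmetries in `S₊ ⊗ e₂`. -/
noncomputable def oddRep : (ℂ × ⋀[ℂ]^2 V × Module.Dual ℂ V) →ₗ[ℂ] SPlus ⊗[ℂ] C2 :=
  (TensorProduct.mk ℂ SPlus C2).flip (e 1) ∘ₗ spinorEquiv.toLinearMap

theorem oddRep_apply (z) : oddRep z = spinorEquiv z ⊗ₜ e 1 := rfl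

/-- No nonzero element of `S₊ ⊗ e₂` is a coboundary, since coboundaries lie in `S₊ ⊗ e₁`. -/
theorem eq_zero_of_b01_eq_oddRep (z : ℂ × ⋀[ℂ]^2 V × Module.Dual ℂ V) (x : so10 × Vec)
    (h : -siso.b01 x (ψ ⊗ₜ e 0) = oddRep z) : z = 0 := by
  rw [siso_b01_tmul, oddRep_apply] at h
  have := congrArg (component 1) h
  rw [map_neg, component_tmul, component_tmul, show e 0 1 = 0 from rfl, show e 1 1 = 1 from rfl,
    one_smul, zero_smul, neg_zero] at this
  exact spinorEquiv.map_eq_zero_iff.1 this.symm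

theorem exists_oddRep_sub (hc : c ≠ 0) (hψ : (ψ : Spinor) = c • 1) (a : SPlus ⊗[ℂ] C2)
    (ha : a ∈ siso.Z₁ (ψ ⊗ₜ e 0)) : ∃ z x, -siso.b01 x (ψ ⊗ₜ e 0) = oddRep z - a := by
  have h0 : gammaPlus ψ (component 0 a) = 0 := by
    rw [LieSuperalgebra.mem_Z₁, siso_b11_tmul_e_zero] at ha
    exact congrArg Prod.snd ha
  obtain ⟨X, hX⟩ := exists_spin_eq hc hψ h0
  refine ⟨spinorEquiv.symm (component 1 a), (X, 0), ?_⟩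
  rw [siso_b01_tmul, hX, oddRep_apply, LinearEquiv.apply_symm_apply]
  conv_rhs => enter [2]; rw [eq_component_add a]
  abel

/-- The odd part of the cohomology. -/
noncomputable def oddEquiv (hc : c ≠ 0) (hψ : (ψ : Spinor) = c • 1) :
    (ℂ × ⋀[ℂ]^2 V × Module.Dual ℂ V) ≃ₗ[ℂ] siso.H₁ (ψ ⊗ₜ e 0) :=
  siso.equivH₁ (ψ ⊗ₜ e 0) oddRep (fun z => tmul_e_one_mem_Z₁ (spinorEquiv z))
    eq_zero_of_b01_eq_oddRep (exists_oddRep_sub hc hψ)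

theorem oddEquiv_apply (hc : c ≠ 0) (hψ : (ψ : Spinor) = c • 1) (z) :
    oddEquiv hc hψ z = siso.mk₁ (ψ ⊗ₜ e 0) (spinorEquiv z ⊗ₜ e 1) (tmul_e_one_mem_Z₁ _) :=
  siso.equivH₁_apply (ψ ⊗ₜ e 0) oddRep (fun z => tmul_e_one_mem_Z₁ (spinorEquiv z))
    eq_zero_of_b01_eq_oddRep (exists_oddRep_sub hc hψ) z

theorem cohomology_b00 (hc : c ≠ 0) (hψ : (ψ : Spinor) = c • 1) (A B : sl5) (τ ω : ⋀[ℂ]^3 V)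
    (v w : V) :
    (siso.cohomology (ψ ⊗ₜ e 0)).b00 (evenEquiv hc hψ ((A, τ), v)) (evenEquiv hc hψ ((B, ω), w)) =
      evenEquiv hc hψ ((⁅A, B⁆, wedgeAct 3 A ω - wedgeAct 3 B τ), A.1 *ᵥ w - B.1 *ᵥ v) := by
  refine siso.cohomology_b00_equiv (ψ ⊗ₜ e 0) _ _ _ ?_
  refine exists_b11_eq_sub hc hψ (stabToSo_lie A B τ ω) fun i => ?_
  simp only [evenRep_apply, siso_b00, stabToSo_mulVec]
  rfl

theorem cohomology_b01 (hc : c ≠ 0) (hψ : (ψ : Spinor) = c • 1) (A : sl5) (a : ℂ) (β : ⋀[ℂ]^2 V)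
    (ξ : Module.Dual ℂ V) :
    (siso.cohomology (ψ ⊗ₜ e 0)).b01 (evenEquiv hc hψ ((A, 0), 0)) (oddEquiv hc hψ (a, β, ξ)) =
      oddEquiv hc hψ (0, wedgeAct 2 A β, dualAct A ξ) := by
  refine siso.cohomology_b01_equiv (ψ ⊗ₜ e 0) _ _ _ ?_
  rw [evenRep_apply, oddRep_apply, oddRep_apply, siso_b01_tmul, stabToSo_sl,
    spin_slToSo_spinorEquiv]

/-- The bracket of two supersymmetries is a translation. -/
theorem cohomology_b11 (hc : c ≠ 0) (hψ : (ψ : Spinor) = c • 1)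
    (z z' : ℂ × ⋀[ℂ]^2 V × Module.Dual ℂ V) :
    (siso.cohomology (ψ ⊗ₜ e 0)).b11 (oddEquiv hc hψ z) (oddEquiv hc hψ z') =
      evenEquiv hc hψ (0, fun i => gammaPlus (spinorEquiv z) (spinorEquiv z') (Sum.inl i)) := by
  refine siso.cohomology_b11_equiv (ψ ⊗ₜ e 0) _ _ _ ?_
  rw [oddRep_apply, oddRep_apply, siso_b11_tmul]
  refine exists_b11_eq_sub hc hψ (map_zero _).symm fun i => ?_
  simp [evenRep_apply]

theorem wedgeAct_zero_left (k : ℕ) (x : ⋀[ℂ]^k V) : wedgeAct k 0 x = 0 := by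
  rw [← Submodule.coe_eq_zero, coe_wedgeAct]
  simp

theorem cohomology_isSemidirectProduct (hc : c ≠ 0) (hψ : (ψ : Spinor) = c • 1) :
    (siso.cohomology (ψ ⊗ₜ e 0)).IsSemidirectProduct
      ((Submodule.prod ⊤ ⊥).map (evenEquiv hc hψ).toLinearMap) ⊥
      ((Submodule.prod ⊥ ⊤).map (evenEquiv hc hψ).toLinearMap) ⊤ := by
  refine LieSuperalgebra.isSemidirectProduct_of_equiv _ _ ?_ ?_
    ((oddEquiv hc hψ).surjective.forall₂.2 fun z z' => ⟨_, cohomology_b11 hc hψ z z'⟩)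
  · rintro ⟨A, τ⟩ ⟨B, ω⟩
    refine ⟨(⁅A, B⁆, wedgeAct 3 A ω - wedgeAct 3 B τ), (cohomology_b00 hc hψ A B τ ω 0 0).trans ?_⟩
    rw [Matrix.mulVec_zero, Matrix.mulVec_zero, sub_zero]
  · rintro ⟨A, τ⟩ v w
    refine ⟨A.1 *ᵥ w, (cohomology_b00 hc hψ A 0 τ 0 v w).trans ?_⟩
    rw [lie_zero, map_zero, wedgeAct_zero_left, sub_zero, ZeroMemClass.coe_zero,
      Matrix.zero_mulVec, sub_zero]
    rfl

/-- `Γ⁺(ψ, ψ) = 0`, because `ψ` has no component in `V*`. -/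
theorem siso_b11_self (hψ : (ψ : Spinor) = c • 1) : siso.b11 (ψ ⊗ₜ e 0) (ψ ⊗ₜ e 0) = 0 := by
  have h : spinorEquiv (c, 0, 0) = ψ := Subtype.ext (by
    rw [hψ, coe_spinorEquiv, spinorOf_apply]
    simp)
  have h0 := gammaPlus_spinorEquiv hψ c 0 0
  have h1 : dualVec 0 = 0 := by ext (i | i) <;> simp [dualVec]
  rw [h, h1, smul_zero] at h0
  rw [siso_b11_tmul, h0, smul_zero]
  rfl

end Constant

end IIB

theorem mainTheorem9 (ψ : SPlus) (hψ : ψ ≠ 0)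
    (hinv : ∀ A : sl5, spin (slToSo A) ψ = 0) :
    -- the supercharge `Q = ψ ⊗ e₁` squares to zero
    siso.b11 (ψ ⊗ₜ e 0) (ψ ⊗ₜ e 0) = 0 ∧
    -- the cohomology is `(sl(5) ⊕ ⋀³ V) ⊕ V ⊕ Π (ℂ ⊕ ⋀² V ⊕ V*)`
    ∃ (Φ₀ : ((sl5 × ⋀[ℂ]^3 V) × V) ≃ₗ[ℂ] siso.H₀ (ψ ⊗ₜ e 0))
      (Φ₁ : (ℂ × ⋀[ℂ]^2 V × Module.Dual ℂ V) ≃ₗ[ℂ] siso.H₁ (ψ ⊗ₜ e 0))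
      (j : (sl5 × ⋀[ℂ]^3 V) →ₗ[ℂ] so10)
      (σ : (ℂ × ⋀[ℂ]^2 V × Module.Dual ℂ V) ≃ₗ[ℂ] SPlus),
      -- `sl(5) ⊕ ⋀³ V ⊂ so(10)` is the stabilizer of `ψ`, and extends `sl(5) ⊂ so(10)`
      Function.Injective j ∧
      (∀ X : so10, X ∈ LinearMap.range j ↔ spin X ψ = 0) ∧
      (∀ A : sl5, j (A, 0) = slToSo A) ∧
      -- representing cocycles: rotations in `sl(5) ⊕ ⋀³ V`, translations in `V`,
      -- and supersymmetries in `S₊ ⊗ e₂`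
      (∀ p v, ∃ h, Φ₀ (p, v) = siso.mk₀ (ψ ⊗ₜ e 0) (j p, Sum.elim v 0) h) ∧
      (∀ z, ∃ h, Φ₁ z = siso.mk₁ (ψ ⊗ₜ e 0) (σ z ⊗ₜ e 1) h) ∧
      -- the even bracket, with `sl(5)` acting naturally on `⋀³ V` and `V`
      (∀ (A B : sl5) (τ ω : ⋀[ℂ]^3 V) (v w : V),
        (siso.cohomology (ψ ⊗ₜ e 0)).b00 (Φ₀ ((A, τ), v)) (Φ₀ ((B, ω), w)) =
          Φ₀ ((⁅A, B⁆, wedgeAct 3 A ω - wedgeAct 3 B τ), A.1 *ᵥ w - B.1 *ᵥ v)) ∧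
      -- `sl(5)` acts naturally on the odd part
      (∀ (A : sl5) (c : ℂ) (β : ⋀[ℂ]^2 V) (ξ : Module.Dual ℂ V),
        (siso.cohomology (ψ ⊗ₜ e 0)).b01 (Φ₀ ((A, 0), 0)) (Φ₁ (c, β, ξ)) =
          Φ₁ (0, wedgeAct 2 A β, dualAct A ξ)) ∧
      -- semidirect product of `sl(5) ⊕ ⋀³ V` with the ideal `V ⊕ Π (ℂ ⊕ ⋀² V ⊕ V*)`
      (siso.cohomology (ψ ⊗ₜ e 0)).IsSemidirectProduct
        ((Submodule.prod ⊤ ⊥).map Φ₀.toLinearMap) ⊥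
        ((Submodule.prod ⊥ ⊤).map Φ₀.toLinearMap) ⊤ := by
  refine Exists.elim (exists_eq_smul_one_of_invariant hinv) fun c hψc => ?_
  have hc : c ≠ 0 := by
    rintro rfl
    exact hψ (Subtype.ext (by rw [hψc, zero_smul]; rfl))
  exact ⟨siso_b11_self hψc, evenEquiv hc hψc, oddEquiv hc hψc, stabToSo, spinorEquiv,
    stabToSo_injective,
    fun X => (mem_range_stabToSo_iff X).trans (spin_eq_zero_iff hc hψc X).symm, stabToSo_sl,
    fun p v => ⟨_, evenEquiv_apply hc hψc p v⟩, fun z => ⟨_, oddEquiv_apply hc hψc z⟩,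
    cohomology_b00 hc hψc, cohomology_b01 hc hψc, cohomology_isSemidirectProduct hc hψc⟩
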